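/- **Setting.** Let $G$ be a Lie group, $H\subset G$ a closed subgroup, and $G/H$ the smooth coset space with origin $o=eH$ and projection $\pi:G\to G/H$ (its smooth structure is the one making $\pi$ a smooth submersion). Let $\mathfrak g=T_eG$, with the bracket given by left invariant vector fields, let $\mathfrak h$ be the Lie algebra of $H$, and let $\mathfrak g=\mathfrak h+\mathfrak m$ be a linear (not necessarily reductive) direct sum decomposition. Write $v_{\mathfrak m}$ for the projection of $v$ to $\mathfrak m$ along $\mathfrak h$, and identify $\mathfrak m=T_o(G/H)$ by $\pi_*$. A *spray structure* on a manifold $M$ is a smooth vector field $\mathbf G$ on $TM\setminus 0$ which in every standard local coordinate $(x^i,y^j)$ of $TM$ has the form $\mathbf G=y^i\partial_{x^i}-2\mathbf G^i\partial_{y^i}$, with $\mathbf G^i(x,\lambda y)=\lambda^2\mathbf G^i(x,y)$ for all $\lambda>0$. A *geodesic* is a smooth curve $c$ with nowhere vanishing velocity such that $(c,\dot c)$ is an integral curve of $\mathbf G$. Given a smooth measure $d\mu=\sigma(x)\,dx^1\cdots dx^n$ (with $\sigma$ smooth and positive in every chart), the *S-curvature* of $\mathbf G$ and $d\mu$ is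 $$\mathbf S(x,y)=\frac{\partial \mathbf G^i}{\partial y^i}(x,y)-\frac{y^i}{\sigma(x)}\frac{\partial\sigma}{\partial x^i}(x),$$ in any standard local coordinate. Let $\mathbf G$ be a $G$-invariant spray structure on $G/H$ (a homogeneous spray). For $y\in\mathfrak m\setminus\{0\}$ let $c$ be the geodesic with $c(0)=o$, $\dot c(0)=y$, and let $\bar c$ be the smooth curve in $G$, defined near $t=0$, with $\bar c(0)=e$, $c(t)=\bar c(t)\cdot o$ and $y(t)=(L_{\bar c(t)^{-1}})_*\dot{\bar c}(t)\in\mathfrak m\setminus\{0\}$. The *spray vector field* is $\eta(y)=-\frac{d}{dt}\big|_{t=0}y(t)$, and the *connection operator* is $N(y,w)=\frac12D\eta(y,w)-\frac12[y,w]_{\mathfrak m}$, where $D\eta(y,w)=\frac{d}{dt}\big|_{t=0}\eta(y+tw)$. **Theorem.** Suppose that the $\mathrm{Ad}(H)$-action on $\mathfrak g/\mathfrak h$ is unimodular, i.e. $|\det(\mathrm{Ad}(g):\mathfrak g/\mathfrak h\to\mathfrak g/\mathfrak h)|=1$ for every $g\in H$. Then for any $G$-invariant smooth measure $d\mu$ on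 $G/H$, the S-curvature of $\mathbf G$ and $d\mu$ satisfies $$\mathbf S(o,y)=\mathrm{Tr}_{\mathbb R}\big(N(y,\cdot)+\mathrm{ad}_{\mathfrak m}(y)\big)\qquad\text{for every } y\in\mathfrak m\setminus\{0\},$$ where $\mathrm{ad}_{\mathfrak m}(y):\mathfrak m\to\mathfrak m$ is the linear map $w\mapsto[y,w]_{\mathfrak m}$. -/

import Mathlib

open Set MeasureTheory
open scoped Manifold ContDiff

noncomputable section

namespace SprayGeometry

/-! ### Spray structures on a smooth manifold -/

section Spray

variable {n : ℕ} {M : Type*} [TopologicalSpace M] [ChartedSpace (EuclideanSpace ℝ (Fin n)) M]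

/-- The standard local coordinates `(x, y)` on `TM` induced by a chart `φ` of `M`:
`x = φ(p)` and `y = (dφ)_p(v)` at the tangent vector `v ∈ T_pM`. -/
def stdCoord (φ : OpenPartialHomeomorph M (EuclideanSpace ℝ (Fin n)))
    (p : TangentBundle (𝓡 n) M) : EuclideanSpace ℝ (Fin n) × EuclideanSpace ℝ (Fin n) :=
  (φ p.1, mfderiv (𝓡 n) (𝓡 n) φ p.1 p.2)

/-- The tangent vector with standard local coordinates `(x, y)`: `y^i ∂_{x^i}` at `φ⁻¹(x)`. -/
def stdCoordSymm (φ : OpenPartialHomeomorph M (EuclideanSpace ℝ (Fin n)))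
    (x y : EuclideanSpace ℝ (Fin n)) : TangentBundle (𝓡 n) M :=
  ⟨φ.symm x, mfderiv (𝓡 n) (𝓡 n) φ.symm x y⟩

variable (n) in
/-- The velocity of a curve. -/
def velocity (c : ℝ → M) (t : ℝ) : TangentSpace (𝓡 n) (c t) :=
  mfderiv 𝓘(ℝ, ℝ) (𝓡 n) c t (1 : ℝ)

variable [IsManifold (𝓡 n) ∞ M]

/-- The components of a tangent vector `ξ` to `TM` at `p` in the frame `∂_{x^i}, ∂_{y^i}` of the
standard local coordinates induced by the chart `φ`. -/
def stdComponents (φ : OpenPartialHomeomorph M (EuclideanSpace ℝ (Fin n)))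
    (p : TangentBundle (𝓡 n) M) (ξ : TangentSpace (𝓡 n).tangent p) :
    EuclideanSpace ℝ (Fin n) × EuclideanSpace ℝ (Fin n) :=
  mfderiv (𝓡 n).tangent
    𝓘(ℝ, EuclideanSpace ℝ (Fin n) × EuclideanSpace ℝ (Fin n)) (stdCoord φ) p ξ

/-- The functions `(G^i)` with `V = (⋯)^i ∂_{x^i} - 2 G^i ∂_{y^i}` in the standard local coordinates
induced by the chart `φ`, as functions of `(x, y)`. -/
def coeff (V : ∀ p : TangentBundle (𝓡 n) M, TangentSpace (𝓡 n).tangent p)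
    (φ : OpenPartialHomeomorph M (EuclideanSpace ℝ (Fin n)))
    (x y : EuclideanSpace ℝ (Fin n)) : EuclideanSpace ℝ (Fin n) :=
  (-(1 / 2 : ℝ)) • (stdComponents φ (stdCoordSymm φ x y) (V (stdCoordSymm φ x y))).2

variable (n M) in
/-- A spray structure: a smooth vector field on `TM \ 0` of the form `y^i ∂_{x^i} - 2 G^i ∂_{y^i}`
in every standard local coordinate system, with `G^i(x, y)` positively 2-homogeneous in `y`.
(The values of `toFun` on the zero section are irrelevant.) -/
structure Spray where
  toFun : ∀ p : TangentBundle (𝓡 n) M, TangentSpace (𝓡 n).tangent p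
  smooth : ContMDiffOn (𝓡 n).tangent (𝓡 n).tangent.tangent ∞
    (fun p => (⟨p, toFun p⟩ : TangentBundle (𝓡 n).tangent (TangentBundle (𝓡 n) M))) {p | p.2 ≠ 0}
  base_component : ∀ φ ∈ IsManifold.maximalAtlas (𝓡 n) ∞ M, ∀ p : TangentBundle (𝓡 n) M,
    p.1 ∈ φ.source → p.2 ≠ 0 → (stdComponents φ p (toFun p)).1 = (stdCoord φ p).2
  homogeneous : ∀ φ ∈ IsManifold.maximalAtlas (𝓡 n) ∞ M, ∀ x ∈ φ.target,
    ∀ y : EuclideanSpace ℝ (Fin n), y ≠ 0 → ∀ r : ℝ, 0 < r →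
      coeff toFun φ x (r • y) = r ^ 2 • coeff toFun φ x y

/-- `c` is a geodesic on the open set `s` of parameters: it is a smooth curve with nowhere
vanishing velocity whose lift `(c, ċ)` to `TM \ 0` is an integral curve of the spray. -/
def Spray.IsGeodesicOn (S : Spray n M) (c : ℝ → M) (s : Set ℝ) : Prop :=
  ContMDiffOn 𝓘(ℝ, ℝ) (𝓡 n) ∞ c s ∧ (∀ t ∈ s, velocity n c t ≠ 0) ∧
    IsMIntegralCurveOn
      (fun t => (⟨c t, velocity n c t⟩ : TangentBundle (𝓡 n) M)) S.toFun s

/-- The spray is invariant under the self-map `f` of `M`: `(f_*)_* S = S` on `TM \ 0`. -/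
def Spray.IsInvariantUnder (S : Spray n M) (f : M → M) : Prop :=
  ∀ p : TangentBundle (𝓡 n) M, p.2 ≠ 0 →
    mfderiv (𝓡 n).tangent (𝓡 n).tangent (tangentMap (𝓡 n) (𝓡 n) f) p (S.toFun p) =
      S.toFun (tangentMap (𝓡 n) (𝓡 n) f p)

/-- `dμ = σ(x) dx^1 ⋯ dx^n` in the chart `φ`, with `σ` smooth and positive. -/
structure IsDensityInChart [MeasurableSpace M] (μ : Measure M)
    (φ : OpenPartialHomeomorph M (EuclideanSpace ℝ (Fin n)))
    (σ : EuclideanSpace ℝ (Fin n) → ℝ) : Prop where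
  smooth : ContDiffOn ℝ ∞ σ φ.target
  pos : ∀ x ∈ φ.target, 0 < σ x
  measure_eq : ∀ A : Set (EuclideanSpace ℝ (Fin n)), MeasurableSet A → A ⊆ φ.target →
    μ (φ.source ∩ φ ⁻¹' A) = ∫⁻ x in A, ENNReal.ofReal (σ x)

variable (n) in
/-- A smooth measure: it has a smooth positive density in every chart. -/
def IsSmoothMeasure [MeasurableSpace M] (μ : Measure M) : Prop :=
  ∀ φ ∈ IsManifold.maximalAtlas (𝓡 n) ∞ M, ∃ σ, IsDensityInChart μ φ σ

/-- The S-curvature `N^i_i(x, y) - (y^i / σ(x)) ∂σ/∂x^i(x)`, where `N^i_j = ∂G^i/∂y^j`, of the spray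
`S` and the measure `σ dx^1 ⋯ dx^n` at the tangent vector `p`, computed in the chart `φ`. -/
def Spray.sCurvatureInChart (S : Spray n M) (φ : OpenPartialHomeomorph M (EuclideanSpace ℝ (Fin n)))
    (σ : EuclideanSpace ℝ (Fin n) → ℝ) (p : TangentBundle (𝓡 n) M) : ℝ :=
  LinearMap.trace ℝ (EuclideanSpace ℝ (Fin n))
      (fderiv ℝ (coeff S.toFun φ (stdCoord φ p).1) (stdCoord φ p).2).toLinearMap
    - fderiv ℝ σ (stdCoord φ p).1 (stdCoord φ p).2 / σ (stdCoord φ p).1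

end Spray

/-! ### Lie groups and their closed subgroups -/

section LieGroups

variable {m : ℕ} {G : Type*} [TopologicalSpace G] [ChartedSpace (EuclideanSpace ℝ (Fin m)) G]
  [Group G] [LieGroup (𝓡 m) ∞ G]

instance : LieGroup (𝓡 m) (minSmoothness ℝ 3) G :=
  LieGroup.of_le (n := ∞) (by simpa using ENat.LEInfty.out)

/-- The adjoint action of `g` on the Lie algebra: the differential at `1` of `x ↦ g x g⁻¹`
(a map from `T_1 G` to `T_{g 1 g⁻¹} G = T_1 G`). -/
def Ad (g : G) : GroupLieAlgebra (𝓡 m) G →L[ℝ] GroupLieAlgebra (𝓡 m) G :=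
  mfderiv (𝓡 m) (𝓡 m) (fun x : G => g * x * g⁻¹) 1

/-- `v` is the velocity at time `0` of a smooth curve in `G` through `1` contained in `H`. -/
def IsTangentTo (H : Subgroup G) (v : GroupLieAlgebra (𝓡 m) G) : Prop :=
  ∃ γ : ℝ → G, ContMDiff 𝓘(ℝ, ℝ) (𝓡 m) ∞ γ ∧ γ 0 = 1 ∧ (∀ t, γ t ∈ H) ∧
    (mfderiv 𝓘(ℝ, ℝ) (𝓡 m) γ 0 (1 : ℝ) : EuclideanSpace ℝ (Fin m)) = v

lemma IsTangentTo.add {H : Subgroup G} {v w : GroupLieAlgebra (𝓡 m) G}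
    (hv : IsTangentTo H v) (hw : IsTangentTo H w) : IsTangentTo H (v + w) := by
  obtain ⟨a, ha, ha0, haH, rfl⟩ := hv
  obtain ⟨b, hb, hb0, hbH, rfl⟩ := hw
  refine ⟨fun t => a t * b t, ha.mul hb, by simp [ha0, hb0], fun t => H.mul_mem (haH t) (hbH t), ?_⟩
  have hf : ContMDiff (𝓘(ℝ, ℝ).prod 𝓘(ℝ, ℝ)) (𝓡 m) ∞ (fun p : ℝ × ℝ => a p.1 * b p.2) :=
    (ha.comp contMDiff_fst).mul (hb.comp contMDiff_snd)
  have hf0 := hf.mdifferentiableAt (x := ((0 : ℝ), (0 : ℝ))) (by simp)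
  have hd : MDifferentiableAt 𝓘(ℝ, ℝ) (𝓘(ℝ, ℝ).prod 𝓘(ℝ, ℝ)) (fun t : ℝ => (t, t)) 0 :=
    mdifferentiableAt_id.prodMk mdifferentiableAt_id
  have h1 := mfderiv_comp_apply (0 : ℝ) (g := fun p : ℝ × ℝ => a p.1 * b p.2)
    (f := fun t : ℝ => (t, t)) hf0 hd (1 : ℝ)
  have h2 := mfderiv_prodMk (I := 𝓘(ℝ, ℝ)) (I' := 𝓘(ℝ, ℝ)) (I'' := 𝓘(ℝ, ℝ)) (x := (0 : ℝ))
    (f := fun t : ℝ => t) (g := fun t : ℝ => t) mdifferentiableAt_id mdifferentiableAt_id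
  rw [h2, mfderiv_prod_eq_add_apply hf0] at h1
  have hid : mfderiv 𝓘(ℝ, ℝ) 𝓘(ℝ, ℝ) (fun t : ℝ => t) 0 (1 : ℝ) = (1 : ℝ) := by
    have := mfderiv_id (I := 𝓘(ℝ, ℝ)) (x := (0 : ℝ))
    exact congrArg (fun L : ℝ →L[ℝ] ℝ => L 1) this
  let F : (ℝ → G) → ℝ → EuclideanSpace ℝ (Fin m) := fun f s => mfderiv 𝓘(ℝ, ℝ) (𝓡 m) f 0 s
  have ea : (fun z => a z * b 0) = a := by funext z; simp [hb0]
  have eb : (fun z => a 0 * b z) = b := by funext z; simp [ha0]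
  have h3 : F (fun t => a t * b t) 1 = F (fun z => a z * b 0)
      (mfderiv 𝓘(ℝ, ℝ) 𝓘(ℝ, ℝ) (fun t : ℝ => t) 0 (1 : ℝ)) + F (fun z => a 0 * b z)
      (mfderiv 𝓘(ℝ, ℝ) 𝓘(ℝ, ℝ) (fun t : ℝ => t) 0 (1 : ℝ)) := h1
  rw [hid, ea, eb] at h3
  exact h3

lemma IsTangentTo.smul {H : Subgroup G} {v : GroupLieAlgebra (𝓡 m) G} (r : ℝ)
    (hv : IsTangentTo H v) : IsTangentTo H (r • v) := by
  obtain ⟨a, ha, ha0, haH, rfl⟩ := hv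
  have hs : ContMDiff 𝓘(ℝ, ℝ) 𝓘(ℝ, ℝ) ∞ (fun t : ℝ => r * t) := by
    rw [contMDiff_iff_contDiff]; fun_prop
  refine ⟨fun t => a (r * t), ha.comp hs, by simp [ha0], fun t => haH _, ?_⟩
  have h1 := mfderiv_comp_apply_of_eq (x := (0 : ℝ)) (y := (0 : ℝ)) (g := a)
    (f := fun t : ℝ => r * t) (ha.mdifferentiableAt (by simp)) (hs.mdifferentiableAt (by simp))
    (by simp) (1 : ℝ)
  have hr : mfderiv 𝓘(ℝ, ℝ) 𝓘(ℝ, ℝ) (fun t : ℝ => r * t) 0 (1 : ℝ) = r • (1 : ℝ) := by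
    rw [mfderiv_eq_fderiv]
    have : HasFDerivAt (fun t : ℝ => r * t) (r • ContinuousLinearMap.id ℝ ℝ) 0 :=
      (hasFDerivAt_id (0 : ℝ)).const_mul r
    rw [this.fderiv]
    rfl
  rw [hr] at h1
  exact h1.trans (map_smul (mfderiv 𝓘(ℝ, ℝ) (𝓡 m) a 0) r (1 : ℝ))

lemma IsTangentTo.zero {H : Subgroup G} : IsTangentTo H (0 : GroupLieAlgebra (𝓡 m) G) := by
  refine ⟨fun _ => 1, contMDiff_const, rfl, fun _ => H.one_mem, ?_⟩
  simp [mfderiv_const]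
  rfl

lemma IsTangentTo.ad {H : Subgroup G} {v : GroupLieAlgebra (𝓡 m) G} {g : G} (hg : g ∈ H)
    (hv : IsTangentTo H v) : IsTangentTo H (Ad g v) := by
  obtain ⟨a, ha, ha0, haH, rfl⟩ := hv
  have hs : ContMDiff (𝓡 m) (𝓡 m) ∞ (fun x : G => g * x * g⁻¹) :=
    (contMDiff_const.mul contMDiff_id).mul contMDiff_const
  refine ⟨fun t => g * a t * g⁻¹, hs.comp ha, by simp [ha0],
    fun t => H.mul_mem (H.mul_mem hg (haH t)) (H.inv_mem hg), ?_⟩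
  have h1 := mfderiv_comp_apply_of_eq (x := (0 : ℝ)) (y := (1 : G)) (g := fun x : G => g * x * g⁻¹)
    (f := a) (hs.mdifferentiableAt (by simp)) (ha.mdifferentiableAt (by simp))
    ha0 (1 : ℝ)
  exact h1

variable (m) in
/-- The Lie algebra of a closed subgroup `H`, as a subspace of the Lie algebra of `G`. -/
def subgroupLieAlgebra (H : Subgroup G) : Submodule ℝ (GroupLieAlgebra (𝓡 m) G) where
  carrier := {v | IsTangentTo H v}
  add_mem' := IsTangentTo.add
  zero_mem' := IsTangentTo.zero
  smul_mem' r _ := IsTangentTo.smul r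

variable (m) in
/-- The action of `Ad(g)`, for `g ∈ H`, on the quotient space `𝔤 / 𝔥`. -/
def AdQuotient (H : Subgroup G) (g : H) :
    (GroupLieAlgebra (𝓡 m) G ⧸ subgroupLieAlgebra m H) →ₗ[ℝ]
      (GroupLieAlgebra (𝓡 m) G ⧸ subgroupLieAlgebra m H) :=
  Submodule.mapQ _ _ (Ad (m := m) (g : G)).toLinearMap fun _ hv => IsTangentTo.ad g.2 hv

variable (m) in
/-- The `Ad(H)`-action on `𝔤 / 𝔥` is unimodular. -/
def IsAdUnimodular (H : Subgroup G) : Prop :=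
  ∀ g : H, |LinearMap.det (AdQuotient m H g)| = 1

variable {H : Subgroup G} {𝔪 : Submodule ℝ (GroupLieAlgebra (𝓡 m) G)}

/-- For a linear decomposition `𝔤 = 𝔥 + 𝔪` and `y ∈ 𝔪`, the linear map `w ↦ [y, w]_𝔪` of `𝔪`. -/
def adM (h𝔪 : IsCompl (subgroupLieAlgebra m H) 𝔪) (y : 𝔪) : 𝔪 →ₗ[ℝ] 𝔪 :=
  𝔪.projectionOnto (subgroupLieAlgebra m H) h𝔪.symm ∘ₗ
    (LieAlgebra.ad ℝ (GroupLieAlgebra (𝓡 m) G) (y : GroupLieAlgebra (𝓡 m) G)) ∘ₗ 𝔪.subtype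

end LieGroups

/-! ### Homogeneous sprays on a smooth coset space -/

section Homogeneous

variable {m n : ℕ} {G : Type*} [TopologicalSpace G] [ChartedSpace (EuclideanSpace ℝ (Fin m)) G]
  [Group G] [LieGroup (𝓡 m) ∞ G] {H : Subgroup G}
  [ChartedSpace (EuclideanSpace ℝ (Fin n)) (G ⧸ H)]

variable (m n H) in
/-- `H` is a closed subgroup of the Lie group `G`, and the given manifold structure on `G ⧸ H` is the
smooth structure of the coset space, i.e. the unique one for which the projection `G → G ⧸ H` is a
smooth submersion. -/
structure IsSmoothCosetSpace : Prop where
  isClosed : IsClosed (H : Set G)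
  submersion : Manifold.IsSubmersion (𝓡 m) (𝓡 n) ∞ (QuotientGroup.mk : G → G ⧸ H)

variable (m n H) in
/-- The vector `v ∈ 𝔤`, viewed as the tangent vector `dπ_e(v)` of `G ⧸ H` at the origin `o = eH`. On
a complement `𝔪` of `𝔥` this is the identification `𝔪 = T_o(G ⧸ H)`. -/
def toOrigin (v : GroupLieAlgebra (𝓡 m) G) : TangentBundle (𝓡 n) (G ⧸ H) :=
  ⟨((1 : G) : G ⧸ H), mfderiv (𝓡 m) (𝓡 n) (QuotientGroup.mk : G → G ⧸ H) 1 v⟩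

variable [IsManifold (𝓡 n) ∞ (G ⧸ H)]

/-- `v = -u'(0)`, where `c` is the geodesic with `c(0) = o` and `ċ(0) = y`, the curve `c̄` in `G` is
the lift of `c` with `c̄(0) = e` whose left-translated velocity `u(t) = (L_{c̄(t)⁻¹})_* c̄'(t)` lies
in `𝔪 \ 0`. -/
def IsSprayVector (S : Spray n (G ⧸ H)) (𝔪 : Submodule ℝ (GroupLieAlgebra (𝓡 m) G))
    (y v : 𝔪) : Prop :=
  ∃ ε > (0 : ℝ), ∃ (c : ℝ → G ⧸ H) (cbar : ℝ → G) (u : ℝ → 𝔪),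
    S.IsGeodesicOn c (Ioo (-ε) ε) ∧
    (⟨c 0, velocity n c 0⟩ : TangentBundle (𝓡 n) (G ⧸ H)) = toOrigin m n H y ∧
    ContMDiffOn 𝓘(ℝ, ℝ) (𝓡 m) ∞ cbar (Ioo (-ε) ε) ∧ cbar 0 = 1 ∧
    (∀ t ∈ Ioo (-ε) ε, c t = (cbar t : G ⧸ H) ∧
      velocity m cbar t =
        mulInvariantVectorField (u t : GroupLieAlgebra (𝓡 m) G) (cbar t) ∧ u t ≠ 0) ∧
    HasDerivAt u (-v) 0

/-- The spray vector field `η : 𝔪 \ 0 → 𝔪` of `S` (its value at `0` is irrelevant). -/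
def sprayVectorField (S : Spray n (G ⧸ H)) (𝔪 : Submodule ℝ (GroupLieAlgebra (𝓡 m) G))
    (y : 𝔪) : 𝔪 :=
  Classical.epsilon fun v => IsSprayVector S 𝔪 y v

/-- The connection operator `N(y, w) = ½ Dη(y, w) - ½ [y, w]_𝔪`, as a linear map in `w`. -/
def connectionOperator (S : Spray n (G ⧸ H)) {𝔪 : Submodule ℝ (GroupLieAlgebra (𝓡 m) G)}
    (h𝔪 : IsCompl (subgroupLieAlgebra m H) 𝔪) (y : 𝔪) : 𝔪 →ₗ[ℝ] 𝔪 :=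
  (1 / 2 : ℝ) • (fderiv ℝ (sprayVectorField S 𝔪) y).toLinearMap - (1 / 2 : ℝ) • adM h𝔪 y

end Homogeneous

end SprayGeometry

end

noncomputable section

namespace SprayGeometry

set_option linter.unusedSectionVars false

open Filter Topology

/-! ### Standard coordinates on the tangent bundle; smoothness of the spray coefficients. -/

section Charts

variable {n : ℕ} {M : Type*} [TopologicalSpace M] [ChartedSpace (EuclideanSpace ℝ (Fin n)) M]
  {φ : OpenPartialHomeomorph M (EuclideanSpace ℝ (Fin n))}

/-! The proof is a computation at `o` in a chart `ψ` of `G` at the identity and a chart `φ` of `G ⧸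
H` at `o`. Write `z₀ = ψ(1)`, `x₀ = φ(o)`, `q = φ ∘ π ∘ ψ⁻¹` (`cosetCoord`), `L(z)` for the left
invariant frame (`leftFrame`, with `L(z₀) = id`) and `B(z) = Dq(z) ∘ L(z)` (`cosetFrame`). The
kernel of `B(z₀)` is `𝔥`, so `B(z₀)` restricts to an isomorphism `b` from `𝔪` onto the model space
of `G ⧸ H`.

Spray side. If `z` is the lift of a geodesic and `z' = L(z)u` with `u` in `𝔪`, then `x = q(z)` has
`x' = B(z)u`. The geodesic equation `x'' = -2 𝐆(x, x')` at time 0 reads `b η(y) = 2 𝐆(x₀, b y) +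
DB(y)y`, where `DB` is the derivative of `B` at `z₀` (`IsSprayVector.cosetFrame_apply`).
Differentiating in `y` gives `b Dη(y, w) = 2 D𝐆(b w) + DB(w)y + DB(y)w`. Symmetry of the second
derivative of `q` gives `b [y, w]_𝔪 = DB(y)w - DB(w)y` (`cosetFrame_adM`). Since `N + ad_𝔪 = ½ Dη +
½ ad_𝔪`, the terms `DB(w)y` cancel, and `b` conjugates `N(y, ·) + ad_𝔪(y)` into `D𝐆 + DB(y) ∘ b⁻¹`
(`cosetFrame_connectionOperator_add_adM`). The trace of `D𝐆` is the first term of the S-curvature.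

Measure side. In the chart `φ` the action of `ψ⁻¹(z)` has derivative `B(z) ∘ b⁻¹` at `x₀`, so
invariance of the measure says `|det (B(z) ∘ b⁻¹)| σ(q(z)) = σ(x₀)`
(`density_mul_abs_det_cosetFrame`). Its logarithmic derivative at `z₀` along `y` is `tr(DB(y) ∘ b⁻¹)
= -Dσ(b y) / σ(x₀)` (`trace_fderiv_cosetFrame`), which is the second term.

The spray vector field is given by a choice operator, so existence of the lifted geodesic must also
be proved (`exists_isSprayVector`); this is a first order ODE for the pair `(z, u)`. -/

lemma mdifferentiable_of_mem_maximalAtlas (hφ : φ ∈ IsManifold.maximalAtlas (𝓡 n) ∞ M) :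
    φ.MDifferentiable (𝓡 n) (𝓡 n) :=
  ⟨(contMDiffOn_of_mem_maximalAtlas hφ).mdifferentiableOn (by simp),
    (contMDiffOn_symm_of_mem_maximalAtlas hφ).mdifferentiableOn (by simp)⟩

variable [IsManifold (𝓡 n) ∞ M]

lemma contMDiffOn_stdCoord (hφ : φ ∈ IsManifold.maximalAtlas (𝓡 n) ∞ M) :
    ContMDiffOn (𝓡 n).tangent 𝓘(ℝ, EuclideanSpace ℝ (Fin n) × EuclideanSpace ℝ (Fin n)) ∞
      (stdCoord φ) {p | p.1 ∈ φ.source} := by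
  have h1 : ContMDiffOn (𝓡 n).tangent (𝓡 n).tangent ∞ (tangentMapWithin (𝓡 n) (𝓡 n) φ φ.source)
      {p | p.1 ∈ φ.source} :=
    (contMDiffOn_of_mem_maximalAtlas hφ).contMDiffOn_tangentMapWithin (by simp)
      φ.open_source.uniqueMDiffOn
  have h2 := (contMDiff_snd_tangentBundle_modelSpace (EuclideanSpace ℝ (Fin n)) (𝓡 n)
    (n := ∞)).comp_contMDiffOn h1
  have h3 := (contMDiffOn_of_mem_maximalAtlas hφ).comp
    (Bundle.contMDiff_proj (TangentSpace (𝓡 n) (M := M)) (IB := 𝓡 n) (n := ∞)).contMDiffOn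
    (s := {p : TangentBundle (𝓡 n) M | p.1 ∈ φ.source})
    (t := φ.source) fun p (hp : p.1 ∈ φ.source) => hp
  refine (h3.prodMk_space h2).congr fun p hp => ?_
  exact congrArg (fun q : TangentBundle (𝓡 n) (EuclideanSpace ℝ (Fin n)) =>
      (φ p.1, (q.2 : EuclideanSpace ℝ (Fin n))))
    (tangentMapWithin_eq_tangentMap (φ.open_source.uniqueMDiffWithinAt hp)
      ((mdifferentiable_of_mem_maximalAtlas hφ).mdifferentiableAt hp)).symm

omit [TopologicalSpace M] [ChartedSpace (EuclideanSpace ℝ (Fin n)) M] [IsManifold (𝓡 n) ∞ M] in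
lemma contMDiff_tangentBundle_mk :
    ContMDiff 𝓘(ℝ, EuclideanSpace ℝ (Fin n) × EuclideanSpace ℝ (Fin n)) (𝓡 n).tangent ∞
      (fun z : EuclideanSpace ℝ (Fin n) × EuclideanSpace ℝ (Fin n) =>
        (⟨z.1, z.2⟩ : TangentBundle (𝓡 n) (EuclideanSpace ℝ (Fin n)))) := by
  intro z
  apply Bundle.contMDiffAt_totalSpace.2
  refine ⟨contDiff_fst.contMDiff.contMDiffAt, ?_⟩
  convert! contDiff_snd.contMDiff.contMDiffAt (n := ∞) using 1
  ext w
  simp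

lemma contMDiffOn_stdCoordSymm (hφ : φ ∈ IsManifold.maximalAtlas (𝓡 n) ∞ M) :
    ContMDiffOn 𝓘(ℝ, EuclideanSpace ℝ (Fin n) × EuclideanSpace ℝ (Fin n)) (𝓡 n).tangent ∞
      (fun z : EuclideanSpace ℝ (Fin n) × EuclideanSpace ℝ (Fin n) => stdCoordSymm φ z.1 z.2)
      (φ.target ×ˢ univ) := by
  have h1 : ContMDiffOn (𝓡 n).tangent (𝓡 n).tangent ∞
      (tangentMapWithin (𝓡 n) (𝓡 n) φ.symm φ.target) {p | p.1 ∈ φ.target} :=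
    (contMDiffOn_symm_of_mem_maximalAtlas hφ).contMDiffOn_tangentMapWithin (by simp)
      φ.open_target.uniqueMDiffOn
  have h3 := h1.comp (contMDiff_tangentBundle_mk.contMDiffOn (s := φ.target ×ˢ univ))
    (fun z hz => hz.1)
  refine h3.congr fun z hz => ?_
  exact (tangentMapWithin_eq_tangentMap (p := ⟨z.1, z.2⟩)
    (φ.open_target.uniqueMDiffWithinAt hz.1)
    ((mdifferentiable_of_mem_maximalAtlas hφ).mdifferentiableAt_symm hz.1)).symm

omit [IsManifold (𝓡 n) ∞ M] in
lemma stdCoordSymm_stdCoord (hφ : φ ∈ IsManifold.maximalAtlas (𝓡 n) ∞ M)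
    {p : TangentBundle (𝓡 n) M} (hp : p.1 ∈ φ.source) :
    stdCoordSymm φ (stdCoord φ p).1 (stdCoord φ p).2 = p := by
  have h := (mdifferentiable_of_mem_maximalAtlas hφ).symm_comp_deriv hp
  have h2 : (mfderiv (𝓡 n) (𝓡 n) φ.symm (φ p.1)) (mfderiv (𝓡 n) (𝓡 n) φ p.1 p.2) = p.2 :=
    congrArg (fun L : TangentSpace (𝓡 n) p.1 →L[ℝ] TangentSpace (𝓡 n) p.1 => L p.2) h
  obtain ⟨a, v⟩ := p
  refine Bundle.TotalSpace.ext (φ.left_inv hp) (heq_of_eq h2)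

omit [IsManifold (𝓡 n) ∞ M] in
lemma stdCoord_stdCoordSymm (hφ : φ ∈ IsManifold.maximalAtlas (𝓡 n) ∞ M)
    {x : EuclideanSpace ℝ (Fin n)} (hx : x ∈ φ.target) (y : EuclideanSpace ℝ (Fin n)) :
    stdCoord φ (stdCoordSymm φ x y) = (x, y) := by
  have h := (mdifferentiable_of_mem_maximalAtlas hφ).comp_symm_deriv hx
  exact Prod.ext (φ.right_inv hx)
    (congrArg (fun L : TangentSpace (𝓡 n) x →L[ℝ] TangentSpace (𝓡 n) x => L y) h)

omit [IsManifold (𝓡 n) ∞ M] in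
lemma stdCoordSymm_snd_ne_zero (hφ : φ ∈ IsManifold.maximalAtlas (𝓡 n) ∞ M)
    {x y : EuclideanSpace ℝ (Fin n)} (hx : x ∈ φ.target) (hy : y ≠ 0) :
    (stdCoordSymm φ x y).2 ≠ 0 := by
  intro h
  have h1 := congrArg Prod.snd (stdCoord_stdCoordSymm hφ hx y)
  apply hy
  refine h1.symm.trans ?_
  change mfderiv (𝓡 n) (𝓡 n) φ (φ.symm x) (stdCoordSymm φ x y).2 = 0
  rw [h]
  exact map_zero _

lemma isOpen_stdCoord_source : IsOpen {p : TangentBundle (𝓡 n) M | p.1 ∈ φ.source} :=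
  φ.open_source.preimage (FiberBundle.continuous_proj _ _)

/-- Up to a linear map, the coefficients are the composite of three smooth maps: inverse standard
coordinates, the spray, and the tangent map of the standard coordinates. The zero section is
excluded because the spray is smooth only off it. -/
lemma contDiffOn_coeff (hφ : φ ∈ IsManifold.maximalAtlas (𝓡 n) ∞ M) (S : Spray n M) :
    ContDiffOn ℝ ∞ (fun z : EuclideanSpace ℝ (Fin n) × EuclideanSpace ℝ (Fin n) =>
      coeff S.toFun φ z.1 z.2) (φ.target ×ˢ {0}ᶜ) := by
  have hL : ContMDiffOn 𝓘(ℝ, EuclideanSpace ℝ (Fin n) × EuclideanSpace ℝ (Fin n)) (𝓡 n).tangent ∞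
      (fun z : EuclideanSpace ℝ (Fin n) × EuclideanSpace ℝ (Fin n) => stdCoordSymm φ z.1 z.2)
      (φ.target ×ˢ {0}ᶜ) :=
    (contMDiffOn_stdCoordSymm hφ).mono (prod_mono subset_rfl (subset_univ _))
  have h1 := S.smooth.comp hL fun z hz => stdCoordSymm_snd_ne_zero hφ hz.1 hz.2
  have h2 := ((contMDiffOn_stdCoord hφ).contMDiffOn_tangentMapWithin (m := ∞) (by simp)
      isOpen_stdCoord_source.uniqueMDiffOn).comp h1
      (fun z hz => show (stdCoordSymm φ z.1 z.2).1 ∈ φ.source from φ.map_target hz.1)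
  have h3 := (contMDiff_snd_tangentBundle_modelSpace
    (EuclideanSpace ℝ (Fin n) × EuclideanSpace ℝ (Fin n))
    𝓘(ℝ, EuclideanSpace ℝ (Fin n) × EuclideanSpace ℝ (Fin n)) (n := ∞)).comp_contMDiffOn h2
  refine (contDiff_snd.comp_contDiffOn h3.contDiffOn).const_smul (-(1 / 2 : ℝ)) |>.congr
    fun z hz => ?_
  have hz' : (stdCoordSymm φ z.1 z.2).1 ∈ φ.source := φ.map_target hz.1
  unfold coeff stdComponents
  have h4 := tangentMapWithin_eq_tangentMap (f := stdCoord φ)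
      (p := ⟨stdCoordSymm φ z.1 z.2, S.toFun (stdCoordSymm φ z.1 z.2)⟩)
      ((isOpen_stdCoord_source (φ := φ)).uniqueMDiffWithinAt (I := (𝓡 n).tangent) hz')
      (((contMDiffOn_stdCoord hφ).contMDiffAt
        (isOpen_stdCoord_source.mem_nhds hz')).mdifferentiableAt (by simp))
  exact congrArg (fun q : TangentBundle 𝓘(ℝ, EuclideanSpace ℝ (Fin n) × EuclideanSpace ℝ (Fin n))
    (EuclideanSpace ℝ (Fin n) × EuclideanSpace ℝ (Fin n)) =>
    -(1 / 2 : ℝ) • (q.2 : EuclideanSpace ℝ (Fin n) × EuclideanSpace ℝ (Fin n)).2) h4.symm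

end Charts

/-! ### Derivatives of curves composed with maps to or from a vector space. -/

section Curves

variable {E : Type*} [NormedAddCommGroup E] [NormedSpace ℝ E] {H : Type*} [TopologicalSpace H]
  {I : ModelWithCorners ℝ E H} {N : Type*} [TopologicalSpace N] [ChartedSpace H N]
  {F : Type*} [NormedAddCommGroup F] [NormedSpace ℝ F]

lemma HasMFDerivAt.hasDerivAt_of_real {f : ℝ → F} {t : ℝ} {L : ℝ →L[ℝ] F}
    (h : HasMFDerivAt 𝓘(ℝ, ℝ) 𝓘(ℝ, F) f t L) : HasDerivAt f (L 1) t := by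
  have h' : HasFDerivAt f L t := h.hasFDerivAt
  exact h'.hasDerivAt

/-- A linear map on `ℝ` is determined by its value at 1; this puts the derivative of a curve into
the shape used in the definition of integral curves. -/
lemma HasMFDerivAt.smulRight_of_apply_one {c : ℝ → N} {t : ℝ} {L : ℝ →L[ℝ] TangentSpace I (c t)}
    (h : HasMFDerivAt 𝓘(ℝ, ℝ) I c t L) {ξ : TangentSpace I (c t)} (hξ : L 1 = ξ) :
    HasMFDerivAt 𝓘(ℝ, ℝ) I c t ((1 : ℝ →L[ℝ] ℝ).smulRight ξ) := by
  have : L = (1 : ℝ →L[ℝ] ℝ).smulRight ξ := by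
    refine ContinuousLinearMap.ext_ring ?_
    simp [hξ]
  exact this ▸ h

lemma hasDerivAt_comp_curve {f : N → F} {c : ℝ → N} {t : ℝ} {L : ℝ →L[ℝ] TangentSpace I (c t)}
    (hf : MDifferentiableAt I 𝓘(ℝ, F) f (c t)) (hc : HasMFDerivAt 𝓘(ℝ, ℝ) I c t L) :
    HasDerivAt (f ∘ c) (mfderiv I 𝓘(ℝ, F) f (c t) (L 1) : F) t :=
  HasMFDerivAt.hasDerivAt_of_real (hf.hasMFDerivAt.comp t hc)

lemma hasMFDerivAt_comp_curve {f : F → N} {c : ℝ → F} {t : ℝ} {w : F}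
    (hf : MDifferentiableAt 𝓘(ℝ, F) I f (c t)) (hc : HasDerivAt c w t) :
    HasMFDerivAt 𝓘(ℝ, ℝ) I (f ∘ c) t
      ((1 : ℝ →L[ℝ] ℝ).smulRight (mfderiv 𝓘(ℝ, F) I f (c t) w)) := by
  refine HasMFDerivAt.smulRight_of_apply_one (hf.hasMFDerivAt.comp t hc.hasFDerivAt.hasMFDerivAt) ?_
  change mfderiv 𝓘(ℝ, F) I f (c t) ((ContinuousLinearMap.toSpanSingleton ℝ w) 1) = _
  simp

end Curves

/-! ### Geodesics as solutions of a second order equation in a chart. -/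

section Geodesics

variable {n : ℕ} {M : Type*} [TopologicalSpace M] [ChartedSpace (EuclideanSpace ℝ (Fin n)) M]
  {φ : OpenPartialHomeomorph M (EuclideanSpace ℝ (Fin n))}

lemma hasDerivAt_chart_comp (hφ : φ ∈ IsManifold.maximalAtlas (𝓡 n) ∞ M) {c : ℝ → M} {t : ℝ}
    (hc : MDifferentiableAt 𝓘(ℝ, ℝ) (𝓡 n) c t) (ht : c t ∈ φ.source) :
    HasDerivAt (φ ∘ c) (mfderiv (𝓡 n) (𝓡 n) φ (c t) (velocity n c t) : EuclideanSpace ℝ (Fin n))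
      t := by
  exact hasDerivAt_comp_curve ((mdifferentiable_of_mem_maximalAtlas hφ).mdifferentiableAt ht)
    hc.hasMFDerivAt

lemma stdCoord_velocity (hφ : φ ∈ IsManifold.maximalAtlas (𝓡 n) ∞ M) {c : ℝ → M} {t : ℝ}
    (hc : MDifferentiableAt 𝓘(ℝ, ℝ) (𝓡 n) c t) (ht : c t ∈ φ.source) :
    stdCoord φ ⟨c t, velocity n c t⟩ = (φ (c t), deriv (φ ∘ c) t) :=
  Prod.ext rfl (hasDerivAt_chart_comp hφ hc ht).deriv.symm

lemma velocity_chart_symm_comp (hφ : φ ∈ IsManifold.maximalAtlas (𝓡 n) ∞ M)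
    {x : ℝ → EuclideanSpace ℝ (Fin n)} {w : EuclideanSpace ℝ (Fin n)} {t : ℝ}
    (hx : HasDerivAt x w t) (ht : x t ∈ φ.target) :
    velocity n (φ.symm ∘ x) t = mfderiv (𝓡 n) (𝓡 n) φ.symm (x t) w := by
  have h := hasMFDerivAt_comp_curve
    ((mdifferentiable_of_mem_maximalAtlas hφ).mdifferentiableAt_symm ht) hx
  rw [velocity, h.mfderiv]
  exact one_smul ℝ _

variable [IsManifold (𝓡 n) ∞ M]

lemma stdComponents_snd (hφ : φ ∈ IsManifold.maximalAtlas (𝓡 n) ∞ M)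
    (V : ∀ p : TangentBundle (𝓡 n) M, TangentSpace (𝓡 n).tangent p)
    {p : TangentBundle (𝓡 n) M} (hp : p.1 ∈ φ.source) :
    (stdComponents φ p (V p)).2 =
      (-2 : ℝ) • coeff V φ (stdCoord φ p).1 (stdCoord φ p).2 := by
  rw [coeff, stdCoordSymm_stdCoord hφ hp, smul_smul]
  norm_num

/-- In standard coordinates the lift `(c, ċ)` is `(x, x')` with `x = φ ∘ c`, so the second component
of the integral curve equation is `x'' = -2 𝐆(x, x')`. -/
lemma Spray.IsGeodesicOn.hasDerivAt_deriv (hφ : φ ∈ IsManifold.maximalAtlas (𝓡 n) ∞ M)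
    {S : Spray n M} {c : ℝ → M} {s : Set ℝ} (hc : S.IsGeodesicOn c s) (hs : IsOpen s) {t : ℝ}
    (ht : t ∈ s) (hct : c t ∈ φ.source) :
    HasDerivAt (deriv (φ ∘ c)) ((-2 : ℝ) • coeff S.toFun φ (φ (c t)) (deriv (φ ∘ c) t)) t := by
  obtain ⟨h1, -, h3⟩ := hc
  have hd : ∀ r ∈ s, MDifferentiableAt 𝓘(ℝ, ℝ) (𝓡 n) c r := fun r hr =>
    (h1.contMDiffAt (hs.mem_nhds hr)).mdifferentiableAt (by simp)
  have h4 := (h3 t ht).hasMFDerivAt (hs.mem_nhds ht)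
  have h5 : MDifferentiableAt (𝓡 n).tangent
      𝓘(ℝ, EuclideanSpace ℝ (Fin n) × EuclideanSpace ℝ (Fin n)) (stdCoord φ)
      (⟨c t, velocity n c t⟩ : TangentBundle (𝓡 n) M) :=
    ((contMDiffOn_stdCoord hφ).contMDiffAt
      (isOpen_stdCoord_source.mem_nhds hct)).mdifferentiableAt (by simp)
  have h6 := hasDerivAt_comp_curve h5 h4
  have h7 : (stdCoord φ ∘ fun t => (⟨c t, velocity n c t⟩ : TangentBundle (𝓡 n) M)) =ᶠ[𝓝 t]
      fun r => (φ (c r), deriv (φ ∘ c) r) := by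
    have := (hd t ht).continuousAt.preimage_mem_nhds (φ.open_source.mem_nhds hct)
    filter_upwards [hs.mem_nhds ht, this] with r hr hr'
    exact stdCoord_velocity hφ (hd r hr) hr'
  have h8 := hasFDerivAt_snd.comp_hasDerivAt t (h7.hasDerivAt_iff.1 h6)
  have h9 := stdComponents_snd hφ S.toFun (p := ⟨c t, velocity n c t⟩) hct
  rw [stdCoord_velocity hφ (hd t ht) hct] at h9
  rw [← h9]
  refine h8.congr_deriv ?_
  exact congrArg (fun v : TangentSpace (𝓡 n).tangent (⟨c t, velocity n c t⟩ : TangentBundle (𝓡 n) M)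
    => (stdComponents φ ⟨c t, velocity n c t⟩ v).2) (one_smul ℝ _)

/-- Chain rule for `stdCoordSymm ∘ stdCoord = id` near `p`: a vector tangent to `TM` is recovered
from its components. -/
lemma mfderiv_stdCoordSymm_stdComponents (hφ : φ ∈ IsManifold.maximalAtlas (𝓡 n) ∞ M)
    {p : TangentBundle (𝓡 n) M} (hp : p.1 ∈ φ.source) (ξ : TangentSpace (𝓡 n).tangent p) :
    (mfderiv 𝓘(ℝ, EuclideanSpace ℝ (Fin n) × EuclideanSpace ℝ (Fin n)) (𝓡 n).tangent
      (fun z : EuclideanSpace ℝ (Fin n) × EuclideanSpace ℝ (Fin n) =>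
        stdCoordSymm (M := M) φ z.1 z.2) (stdCoord φ p) (stdComponents φ p ξ) :
      EuclideanSpace ℝ (Fin n) × EuclideanSpace ℝ (Fin n)) = ξ := by
  have hLd : MDifferentiableAt 𝓘(ℝ, EuclideanSpace ℝ (Fin n) × EuclideanSpace ℝ (Fin n))
      (𝓡 n).tangent (fun z : EuclideanSpace ℝ (Fin n) × EuclideanSpace ℝ (Fin n) =>
        stdCoordSymm (M := M) φ z.1 z.2) (stdCoord φ p) :=
    ((contMDiffOn_stdCoordSymm hφ).contMDiffAt ((φ.open_target.prod isOpen_univ).mem_nhds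
      ⟨φ.map_source hp, mem_univ _⟩)).mdifferentiableAt (by simp)
  have hC : MDifferentiableAt (𝓡 n).tangent
      𝓘(ℝ, EuclideanSpace ℝ (Fin n) × EuclideanSpace ℝ (Fin n)) (stdCoord φ) p :=
    ((contMDiffOn_stdCoord hφ).contMDiffAt
      (isOpen_stdCoord_source.mem_nhds hp)).mdifferentiableAt (by simp)
  have h1 := hLd.hasMFDerivAt.comp p hC.hasMFDerivAt
  have h2 : HasMFDerivAt (𝓡 n).tangent (𝓡 n).tangent
      ((fun z : EuclideanSpace ℝ (Fin n) × EuclideanSpace ℝ (Fin n) =>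
        stdCoordSymm (M := M) φ z.1 z.2) ∘ stdCoord φ) p
      (ContinuousLinearMap.id ℝ (TangentSpace (𝓡 n).tangent p)) := by
    refine (hasMFDerivAt_id p).congr_of_eventuallyEq ?_
    filter_upwards [isOpen_stdCoord_source.mem_nhds hp] with q hq
    exact stdCoordSymm_stdCoord hφ hq
  exact congrArg (fun L : (EuclideanSpace ℝ (Fin n) × EuclideanSpace ℝ (Fin n)) →L[ℝ]
    (EuclideanSpace ℝ (Fin n) × EuclideanSpace ℝ (Fin n)) => L ξ) (hasMFDerivAt_unique h1 h2)

/-- Converse of `Spray.IsGeodesicOn.hasDerivAt_deriv`. The components of the spray at `(x, w)` are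
`(w, -2 𝐆(x, w))`, the first by `base_component`, and this is the derivative of `(x, w)`. -/
lemma Spray.isGeodesicOn_chart_symm_comp (hφ : φ ∈ IsManifold.maximalAtlas (𝓡 n) ∞ M)
    {S : Spray n M} {x w : ℝ → EuclideanSpace ℝ (Fin n)} {s : Set ℝ} (hs : IsOpen s)
    (hx : ContDiffOn ℝ ∞ x s) (hxs : ∀ t ∈ s, x t ∈ φ.target)
    (hxw : ∀ t ∈ s, HasDerivAt x (w t) t) (hw0 : ∀ t ∈ s, w t ≠ 0)
    (hw : ∀ t ∈ s, HasDerivAt w ((-2 : ℝ) • coeff S.toFun φ (x t) (w t)) t) :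
    S.IsGeodesicOn (φ.symm ∘ x) s := by
  have hv : ∀ t ∈ s, (⟨(φ.symm ∘ x) t, velocity n (φ.symm ∘ x) t⟩ : TangentBundle (𝓡 n) M) =
      stdCoordSymm φ (x t) (w t) := fun t ht =>
    Bundle.TotalSpace.ext rfl
      (heq_of_eq (velocity_chart_symm_comp hφ (hxw t ht) (hxs t ht)))
  refine ⟨(contMDiffOn_symm_of_mem_maximalAtlas hφ).comp hx.contMDiffOn hxs, fun t ht => ?_,
    fun t ht => ?_⟩
  · rw [velocity_chart_symm_comp hφ (hxw t ht) (hxs t ht)]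
    exact stdCoordSymm_snd_ne_zero hφ (hxs t ht) (hw0 t ht)
  · apply HasMFDerivAt.hasMFDerivWithinAt
    have hLd : MDifferentiableAt 𝓘(ℝ, EuclideanSpace ℝ (Fin n) × EuclideanSpace ℝ (Fin n))
        (𝓡 n).tangent (fun z : EuclideanSpace ℝ (Fin n) × EuclideanSpace ℝ (Fin n) =>
          stdCoordSymm (M := M) φ z.1 z.2) (x t, w t) :=
      ((contMDiffOn_stdCoordSymm hφ).contMDiffAt
        ((φ.open_target.prod isOpen_univ).mem_nhds ⟨hxs t ht, mem_univ _⟩)).mdifferentiableAt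
          (by simp)
    have h1 := hasMFDerivAt_comp_curve (c := fun r => (x r, w r)) hLd ((hxw t ht).prodMk (hw t ht))
    have h2 : (fun r => (⟨(φ.symm ∘ x) r, velocity n (φ.symm ∘ x) r⟩ : TangentBundle (𝓡 n) M))
        =ᶠ[𝓝 t] fun r => stdCoordSymm φ (x r) (w r) := by
      filter_upwards [hs.mem_nhds ht] with r hr using hv r hr
    have h3 := h1.congr_of_eventuallyEq h2
    have hp : (stdCoordSymm φ (x t) (w t)).1 ∈ φ.source := φ.map_target (hxs t ht)
    have h4 := mfderiv_stdCoordSymm_stdComponents hφ hp (S.toFun (stdCoordSymm φ (x t) (w t)))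
    have h5 : stdComponents φ (stdCoordSymm φ (x t) (w t)) (S.toFun (stdCoordSymm φ (x t) (w t))) =
        (w t, (-2 : ℝ) • coeff S.toFun φ (x t) (w t)) := by
      refine Prod.ext ?_ ?_
      · rw [S.base_component φ hφ _ hp (stdCoordSymm_snd_ne_zero hφ (hxs t ht) (hw0 t ht)),
          stdCoord_stdCoordSymm hφ (hxs t ht)]
      · rw [stdComponents_snd hφ S.toFun hp, stdCoord_stdCoordSymm hφ (hxs t ht)]
    rw [h5, stdCoord_stdCoordSymm hφ (hxs t ht)] at h4
    refine HasMFDerivAt.smulRight_of_apply_one h3 ?_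
    -- The tangent spaces at equal points are different types over the same model space, so the
    -- equality of points is transported by substitution.
    have h6 : ∀ p q : TangentBundle (𝓡 n) M, p = q →
        (S.toFun p : EuclideanSpace ℝ (Fin n) × EuclideanSpace ℝ (Fin n)) = S.toFun q := by
      rintro p _ rfl
      rfl
    exact (one_smul ℝ _).trans (h4.trans (h6 _ _ (hv t ht).symm))

end Geodesics

/-! ### Submersions: surjective differential, and curves inside a fibre. -/

section Submersions

variable {m n : ℕ} {M N : Type*} [TopologicalSpace M] [ChartedSpace (EuclideanSpace ℝ (Fin m)) M]
  [TopologicalSpace N] [ChartedSpace (EuclideanSpace ℝ (Fin n)) N]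
  {F : Type*} [NormedAddCommGroup F] [NormedSpace ℝ F] {f : M → N} {x : M}

lemma codChart_apply (h : Manifold.IsSubmersionAtOfComplement F (𝓡 m) (𝓡 n) ∞ f x) {p : M}
    (hp : p ∈ h.domChart.source) : h.codChart (f p) = (h.equiv (h.domChart p)).1 := by
  have hp' : h.domChart p ∈ (h.domChart.extend (𝓡 m)).target := by
    simpa using h.domChart.map_source hp
  have := h.writtenInCharts hp'
  simpa [h.domChart.left_inv hp] using this

lemma mfderiv_codChart_mfderiv (h : Manifold.IsSubmersionAtOfComplement F (𝓡 m) (𝓡 n) ∞ f x)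
    (v : TangentSpace (𝓡 m) x) :
    (mfderiv (𝓡 n) (𝓡 n) h.codChart (f x) (mfderiv (𝓡 m) (𝓡 n) f x v) : EuclideanSpace ℝ (Fin n)) =
      (h.equiv (mfderiv (𝓡 m) (𝓡 m) h.domChart x v)).1 := by
  have hf : MDifferentiableAt (𝓡 m) (𝓡 n) f x := h.contMDiffAt.mdifferentiableAt (by simp)
  have h1 := ((mdifferentiable_of_mem_maximalAtlas h.codChart_mem_maximalAtlas).mdifferentiableAt
    h.mem_codChart_source).hasMFDerivAt.comp x hf.hasMFDerivAt
  have hL : HasFDerivAt (fun w => (h.equiv w).1)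
      ((ContinuousLinearMap.fst ℝ (EuclideanSpace ℝ (Fin n)) F).comp
        (h.equiv : EuclideanSpace ℝ (Fin m) →L[ℝ] EuclideanSpace ℝ (Fin n) × F)) (h.domChart x) :=
    ((ContinuousLinearMap.fst ℝ (EuclideanSpace ℝ (Fin n)) F).comp
        (h.equiv : EuclideanSpace ℝ (Fin m) →L[ℝ] EuclideanSpace ℝ (Fin n) × F)).hasFDerivAt
  have h2 := hL.hasMFDerivAt.comp x
    ((mdifferentiable_of_mem_maximalAtlas h.domChart_mem_maximalAtlas).mdifferentiableAt
      h.mem_domChart_source).hasMFDerivAt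
  have h3 : h.codChart ∘ f =ᶠ[𝓝 x] (fun w => (h.equiv w).1) ∘ h.domChart := by
    filter_upwards [h.domChart.open_source.mem_nhds h.mem_domChart_source] with p hp
      using codChart_apply h hp
  exact congrArg (fun L : EuclideanSpace ℝ (Fin m) →L[ℝ] EuclideanSpace ℝ (Fin n) => L v)
    (hasMFDerivAt_unique h1 (h2.congr_of_eventuallyEq h3))

lemma mfderiv_surjective_of_isSubmersionAt
    (h : Manifold.IsSubmersionAtOfComplement F (𝓡 m) (𝓡 n) ∞ f x) :
    Function.Surjective (mfderiv (𝓡 m) (𝓡 n) f x) := by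
  intro w
  have hd := (mdifferentiable_of_mem_maximalAtlas h.domChart_mem_maximalAtlas).mfderiv_surjective
    h.mem_domChart_source
  obtain ⟨v, hv⟩ := hd (h.equiv.symm (mfderiv (𝓡 n) (𝓡 n) h.codChart (f x) w, (0 : F)))
  refine ⟨v, (mdifferentiable_of_mem_maximalAtlas h.codChart_mem_maximalAtlas).mfderiv_injective
    h.mem_codChart_source ?_⟩
  refine (mfderiv_codChart_mfderiv h v).trans ?_
  rw [hv]
  simp

/-- In charts adapted to the submersion `f` is a linear projection, so a straight line whose
direction is killed by the projection stays in the fibre. -/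
lemma exists_curve_in_fiber (h : Manifold.IsSubmersionAtOfComplement F (𝓡 m) (𝓡 n) ∞ f x)
    {v : TangentSpace (𝓡 m) x} (hv : mfderiv (𝓡 m) (𝓡 n) f x v = 0) :
    ∃ γ : ℝ → M, ContMDiff 𝓘(ℝ, ℝ) (𝓡 m) ∞ γ ∧ γ 0 = x ∧ (∀ t, f (γ t) = f x) ∧
      (mfderiv 𝓘(ℝ, ℝ) (𝓡 m) γ 0 (1 : ℝ) : EuclideanSpace ℝ (Fin m)) = v := by
  set d := h.domChart
  have hmd := mdifferentiable_of_mem_maximalAtlas h.domChart_mem_maximalAtlas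
  have hx : x ∈ d.source := h.mem_domChart_source
  set w : EuclideanSpace ℝ (Fin m) := mfderiv (𝓡 m) (𝓡 m) d x v with hw
  have hw0 : (h.equiv w).1 = 0 := by
    rw [← mfderiv_codChart_mfderiv h v, hv]
    exact map_zero _
  have hcont : Continuous fun r : ℝ => d x + r • w := by fun_prop
  have hmem : (fun r : ℝ => d x + r • w) ⁻¹' d.target ∈ 𝓝 0 :=
    hcont.continuousAt.preimage_mem_nhds
      (d.open_target.mem_nhds (by simpa using d.map_source hx))
  obtain ⟨δ, hδ, hball⟩ := Metric.mem_nhds_iff.1 hmem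
  -- The curve must be defined for all times, while the line leaves the chart. This
  -- reparametrization has `|ρ| ≤ δ / 2` and `ρ'(0) = 1`, so it keeps the line in the chart without
  -- changing its velocity at 0.
  let ρ : ℝ → ℝ := fun t => δ / 2 * Real.sin (2 / δ * t)
  have hρ : ∀ t, d x + ρ t • w ∈ d.target := fun t => by
    apply hball
    rw [mem_ball_zero_iff, Real.norm_eq_abs, abs_mul, abs_of_pos (by positivity)]
    nlinarith [Real.abs_sin_le_one (2 / δ * t)]
  have hρd : HasDerivAt ρ 1 0 := by
    have h1 : HasDerivAt (fun t : ℝ => 2 / δ * t) (2 / δ) 0 := by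
      simpa using (hasDerivAt_id (0 : ℝ)).const_mul (2 / δ)
    have := h1.sin.const_mul (δ / 2)
    refine this.congr_deriv ?_
    simp
    field_simp
  have hσ : ContDiff ℝ ∞ fun t => d x + ρ t • w := by
    have : ContDiff ℝ ∞ ρ := contDiff_const.mul (Real.contDiff_sin.comp (contDiff_const.mul contDiff_id))
    fun_prop
  have hσd : HasDerivAt (fun t => d x + ρ t • w) w 0 := by
    simpa using (hρd.smul_const w).const_add (d x)
  have hρ0 : ρ 0 = 0 := by simp [ρ]
  refine ⟨d.symm ∘ fun t => d x + ρ t • w, ?_, ?_, fun t => ?_, ?_⟩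
  · rw [← contMDiffOn_univ]
    exact (contMDiffOn_symm_of_mem_maximalAtlas h.domChart_mem_maximalAtlas).comp
      hσ.contMDiff.contMDiffOn fun t _ => hρ t
  · simp [hρ0, d.left_inv hx]
  · have hs := d.map_target (hρ t)
    refine h.codChart.injOn (h.source_subset_preimage_source hs) h.mem_codChart_source ?_
    refine (codChart_apply h hs).trans (Eq.trans ?_ (codChart_apply h hx).symm)
    change (h.equiv (d (d.symm _))).1 = (h.equiv (d x)).1
    rw [d.right_inv (hρ t)]
    simp [hw0]
  · have h1 := velocity_chart_symm_comp h.domChart_mem_maximalAtlas hσd (hρ 0)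
    have h2 : d x + ρ 0 • w = d x := by simp [hρ0]
    rw [h2] at h1
    refine h1.trans ?_
    exact congrArg (fun L : EuclideanSpace ℝ (Fin m) →L[ℝ] EuclideanSpace ℝ (Fin m) => L v)
      (hmd.symm_comp_deriv hx)

end Submersions

/-! ### Left invariant fields and the Lie bracket in a chart at the identity. -/

section GroupChart

variable {m : ℕ} {G : Type*} [TopologicalSpace G] [ChartedSpace (EuclideanSpace ℝ (Fin m)) G]
  [Group G]

variable (m G) in
/-- The preferred chart of `G` at the identity. -/
abbrev chartOne : OpenPartialHomeomorph G (EuclideanSpace ℝ (Fin m)) := chartAt _ (1 : G)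

variable (m G) in
/-- The coordinates of the identity. -/
abbrev coordOne : EuclideanSpace ℝ (Fin m) := chartOne m G 1

variable (m G) in
/-- The multiplication of `G` in the chart at the identity. -/
def chartMul (z s : EuclideanSpace ℝ (Fin m)) : EuclideanSpace ℝ (Fin m) :=
  chartOne m G ((chartOne m G).symm z * (chartOne m G).symm s)

variable (m G) in
/-- The left invariant fields in the chart at the identity: `leftFrame m G z v` is the value at the
point with coordinates `z` of the left invariant field extending `v`. -/
def leftFrame (z : EuclideanSpace ℝ (Fin m)) :
    EuclideanSpace ℝ (Fin m) →L[ℝ] EuclideanSpace ℝ (Fin m) :=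
  fderiv ℝ (chartMul m G z) (coordOne m G)

lemma one_mem_chartOne_source : (1 : G) ∈ (chartOne m G).source := mem_chart_source _ _

lemma coordOne_mem_target : coordOne m G ∈ (chartOne m G).target := mem_chart_target _ _

lemma chartOne_symm_coordOne : (chartOne m G).symm (coordOne m G) = 1 :=
  (chartOne m G).left_inv one_mem_chartOne_source

variable [LieGroup (𝓡 m) ∞ G]

lemma chartOne_mem_maximalAtlas : chartOne m G ∈ IsManifold.maximalAtlas (𝓡 m) ∞ G :=
  IsManifold.chart_mem_maximalAtlas _

lemma contMDiffOn_symm_mul_symm :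
    ContMDiffOn 𝓘(ℝ, EuclideanSpace ℝ (Fin m) × EuclideanSpace ℝ (Fin m)) (𝓡 m) ∞
      (fun p : EuclideanSpace ℝ (Fin m) × EuclideanSpace ℝ (Fin m) =>
        (chartOne m G).symm p.1 * (chartOne m G).symm p.2)
      ((chartOne m G).target ×ˢ (chartOne m G).target) := by
  have h := contMDiffOn_symm_of_mem_maximalAtlas (chartOne_mem_maximalAtlas (m := m) (G := G))
  exact (h.comp contDiff_fst.contMDiff.contMDiffOn fun p hp => hp.1).mul
    (h.comp contDiff_snd.contMDiff.contMDiffOn fun p hp => hp.2)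

lemma contDiffAt_chartMul {z s : EuclideanSpace ℝ (Fin m)} (hz : z ∈ (chartOne m G).target)
    (hs : s ∈ (chartOne m G).target)
    (h : (chartOne m G).symm z * (chartOne m G).symm s ∈ (chartOne m G).source) :
    ContDiffAt ℝ ∞ (Function.uncurry (chartMul m G)) (z, s) := by
  have h1 := (contMDiffOn_symm_mul_symm (m := m) (G := G)).contMDiffAt (x := (z, s))
    (((chartOne m G).open_target.prod (chartOne m G).open_target).mem_nhds ⟨hz, hs⟩)
  exact ((contMDiffAt_of_mem_maximalAtlas (chartOne_mem_maximalAtlas (m := m) (G := G)) h).comp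
    (z, s) h1).contDiffAt

lemma contDiffAt_chartMul_coordOne {z : EuclideanSpace ℝ (Fin m)}
    (hz : z ∈ (chartOne m G).target) :
    ContDiffAt ℝ ∞ (Function.uncurry (chartMul m G)) (z, coordOne m G) :=
  contDiffAt_chartMul hz coordOne_mem_target
    (by simpa [chartOne_symm_coordOne] using (chartOne m G).map_target hz)

lemma contDiffAt_leftFrame {z : EuclideanSpace ℝ (Fin m)} (hz : z ∈ (chartOne m G).target) :
    ContDiffAt ℝ ∞ (leftFrame m G) z :=
  ContDiffAt.fderiv (contDiffAt_chartMul_coordOne hz) contDiffAt_const (by simp)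

lemma hasFDerivAt_chartMul {z : EuclideanSpace ℝ (Fin m)} (hz : z ∈ (chartOne m G).target) :
    HasFDerivAt (chartMul m G z) (leftFrame m G z) (coordOne m G) := by
  refine DifferentiableAt.hasFDerivAt ?_
  have := ((contDiffAt_chartMul_coordOne hz).differentiableAt (by simp))
  exact this.comp (coordOne m G)
    ((differentiableAt_const z).prodMk differentiableAt_id : DifferentiableAt ℝ (fun s => (z, s)) _)

/-- The tangent space at a point is identified with the model space through the preferred chart
there, so the differential of that chart at its centre is the identity. Elements of `𝔤` are thus
their own coordinate vectors. -/
lemma mfderiv_chartOne_one (v : GroupLieAlgebra (𝓡 m) G) :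
    (mfderiv (𝓡 m) (𝓡 m) (chartOne m G) 1 v : EuclideanSpace ℝ (Fin m)) = v := by
  have := mfderiv_extChartAt_self (I := 𝓡 m) (x := (1 : G))
  exact congrArg (fun L : EuclideanSpace ℝ (Fin m) →L[ℝ] EuclideanSpace ℝ (Fin m) => L v) this

lemma mfderiv_chartOne_mulInvariantVectorField {g : G} (hg : g ∈ (chartOne m G).source)
    (v : GroupLieAlgebra (𝓡 m) G) :
    (mfderiv (𝓡 m) (𝓡 m) (chartOne m G) g (mulInvariantVectorField v g) :
      EuclideanSpace ℝ (Fin m)) = leftFrame m G (chartOne m G g) v := by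
  have hψ := mdifferentiable_of_mem_maximalAtlas (chartOne_mem_maximalAtlas (m := m) (G := G))
  have hL : MDifferentiableAt (𝓡 m) (𝓡 m) (fun x : G => g * x) 1 :=
    (contMDiff_mul_left (I := 𝓡 m) (n := ∞)).contMDiffAt.mdifferentiableAt (by simp)
  have hg' : g * 1 ∈ (chartOne m G).source := by rwa [mul_one]
  have h1 := (hψ.mdifferentiableAt hg').hasMFDerivAt.comp (1 : G) hL.hasMFDerivAt
  have h2 := (hasFDerivAt_chartMul ((chartOne m G).map_source hg)).hasMFDerivAt.comp (1 : G)
    (hψ.mdifferentiableAt one_mem_chartOne_source).hasMFDerivAt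
  have h3 : (chartOne m G) ∘ (fun x : G => g * x) =ᶠ[𝓝 1]
      chartMul m G (chartOne m G g) ∘ chartOne m G := by
    filter_upwards [(chartOne m G).open_source.mem_nhds one_mem_chartOne_source] with p hp
    simp only [Function.comp, chartMul, (chartOne m G).left_inv hg, (chartOne m G).left_inv hp]
  have h4 : mfderiv (𝓡 m) (𝓡 m) (chartOne m G) (g * 1)
        (mfderiv (𝓡 m) (𝓡 m) (fun x : G => g * x) 1 v) =
      leftFrame m G (chartOne m G g) (mfderiv (𝓡 m) (𝓡 m) (chartOne m G) 1 v) :=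
    congrArg (fun L : EuclideanSpace ℝ (Fin m) →L[ℝ] EuclideanSpace ℝ (Fin m) => L v)
      (hasMFDerivAt_unique h1 (h2.congr_of_eventuallyEq h3))
  rw [mfderiv_chartOne_one] at h4
  refine Eq.trans ?_ h4
  -- The chain rule produces the differential at `g * 1`, which equals `g` only propositionally.
  have h5 : ∀ p : G, p = g → (mfderiv (𝓡 m) (𝓡 m) (chartOne m G) g :
      EuclideanSpace ℝ (Fin m) → EuclideanSpace ℝ (Fin m)) =
      mfderiv (𝓡 m) (𝓡 m) (chartOne m G) p := by
    rintro _ rfl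
    rfl
  exact congrFun (h5 (g * 1) (mul_one g)) _

lemma leftFrame_coordOne (v : EuclideanSpace ℝ (Fin m)) : leftFrame m G (coordOne m G) v = v := by
  refine (mfderiv_chartOne_mulInvariantVectorField one_mem_chartOne_source v).symm.trans ?_
  rw [mfderiv_chartOne_one]
  have h : (fun x : G => 1 * x) = id := by
    funext x
    simp
  have h1 : ∀ f : G → G, f = id → (mfderiv (𝓡 m) (𝓡 m) f 1 :
      EuclideanSpace ℝ (Fin m) → EuclideanSpace ℝ (Fin m)) = id := by
    rintro _ rfl
    rw [mfderiv_id]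
    rfl
  exact congrFun (h1 _ h) v

lemma velocity_eq_mulInvariantVectorField_iff {c : ℝ → G} {t : ℝ}
    (hc : MDifferentiableAt 𝓘(ℝ, ℝ) (𝓡 m) c t) (ht : c t ∈ (chartOne m G).source)
    (v : GroupLieAlgebra (𝓡 m) G) :
    velocity m c t = mulInvariantVectorField v (c t) ↔
      HasDerivAt (chartOne m G ∘ c) (leftFrame m G (chartOne m G (c t)) v) t := by
  have h := hasDerivAt_chart_comp chartOne_mem_maximalAtlas hc ht
  rw [← mfderiv_chartOne_mulInvariantVectorField ht]
  refine ⟨fun h' => h' ▸ h, fun h' => ?_⟩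
  exact (mdifferentiable_of_mem_maximalAtlas chartOne_mem_maximalAtlas).mfderiv_injective ht
    (h.unique h')

/-- In the chart the left invariant fields are `z ↦ L(z)v` and `z ↦ L(z)w`. Their bracket is the
derivative of the second along the first minus the reverse, and `L` is the identity at `z₀`. -/
lemma bracket_eq_fderiv_leftFrame (v w : GroupLieAlgebra (𝓡 m) G) :
    (⁅v, w⁆ : GroupLieAlgebra (𝓡 m) G) =
      fderiv ℝ (leftFrame m G) (coordOne m G) v w -
        fderiv ℝ (leftFrame m G) (coordOne m G) w v := by
  have hψ := mdifferentiable_of_mem_maximalAtlas (chartOne_mem_maximalAtlas (m := m) (G := G))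
  have key : ∀ v : GroupLieAlgebra (𝓡 m) G,
      VectorField.mpullbackWithin 𝓘(ℝ, EuclideanSpace ℝ (Fin m)) (𝓡 m)
        (extChartAt (𝓡 m) (1 : G)).symm (mulInvariantVectorField v) (range (𝓡 m))
      =ᶠ[𝓝 (coordOne m G)] fun z => leftFrame m G z v := by
    intro v
    filter_upwards [(chartOne m G).open_target.mem_nhds coordOne_mem_target] with z hz
    have h1 := mfderiv_chartOne_mulInvariantVectorField ((chartOne m G).map_target hz) v
    rw [(chartOne m G).right_inv hz] at h1
    rw [← h1, VectorField.mpullbackWithin_apply]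
    have h2 : (mfderivWithin 𝓘(ℝ, EuclideanSpace ℝ (Fin m)) (𝓡 m)
        (extChartAt (𝓡 m) (1 : G)).symm (range (𝓡 m)) z).inverse =
        mfderiv (𝓡 m) (𝓡 m) (chartOne m G) ((chartOne m G).symm z) := by
      have hz' : z ∈ (extChartAt (𝓡 m) (1 : G)).target := by simpa using hz
      exact ContinuousLinearMap.inverse_eq
        (mfderivWithin_extChartAt_symm_comp_mfderiv_extChartAt hz')
        (mfderiv_extChartAt_comp_mfderivWithin_extChartAt_symm hz')
    rw [h2]
    rfl
  have hd := (contDiffAt_leftFrame (coordOne_mem_target (m := m) (G := G))).differentiableAt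
    (by simp)
  have hfd : ∀ v w : EuclideanSpace ℝ (Fin m),
      fderiv ℝ (fun z => leftFrame m G z v) (coordOne m G) w =
        fderiv ℝ (leftFrame m G) (coordOne m G) w v := by
    intro v w
    rw [(hd.hasFDerivAt.clm_apply (hasFDerivAt_const v _)).fderiv]
    simp
  have hinv : ∀ (L : EuclideanSpace ℝ (Fin m) →L[ℝ] EuclideanSpace ℝ (Fin m)),
      L = ContinuousLinearMap.id ℝ _ → ∀ u, L.inverse u = u := by
    rintro _ rfl u
    simp
  refine (hinv _ (mfderiv_extChartAt_self (I := 𝓡 m) (x := (1 : G))) _).trans ?_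
  have hset : (extChartAt (𝓡 m) (1 : G)).symm ⁻¹' univ ∩ range (𝓡 m) = univ := by simp
  have huniv : ∀ (V W : EuclideanSpace ℝ (Fin m) → EuclideanSpace ℝ (Fin m))
      (s : Set (EuclideanSpace ℝ (Fin m))) (z : EuclideanSpace ℝ (Fin m)), s = univ →
      VectorField.lieBracketWithin ℝ V W s z = VectorField.lieBracket ℝ V W z := by
    rintro V W _ z rfl
    rw [VectorField.lieBracketWithin_univ]
  refine (huniv _ _ _ _ hset).trans ?_
  refine ((key v).lieBracket_vectorField_eq (key w)).trans ?_
  rw [VectorField.lieBracket_eq]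
  refine congrArg₂ (· - ·) ((hfd w _).trans ?_) ((hfd v _).trans ?_)
  · exact congrArg (fun u => fderiv ℝ (leftFrame m G) (coordOne m G) u w) (leftFrame_coordOne v)
  · exact congrArg (fun u => fderiv ℝ (leftFrame m G) (coordOne m G) u v) (leftFrame_coordOne w)

end GroupChart

/-! ### The projection to the coset space in coordinates, and `𝔪` as tangent space at the origin. -/

section CosetCoordinates

variable {m n : ℕ} {G : Type*} [TopologicalSpace G] [ChartedSpace (EuclideanSpace ℝ (Fin m)) G]
  [Group G] (H : Subgroup G) [ChartedSpace (EuclideanSpace ℝ (Fin n)) (G ⧸ H)]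
  (φ : OpenPartialHomeomorph (G ⧸ H) (EuclideanSpace ℝ (Fin n)))

/-- The projection `G → G ⧸ H` in the chart of `G` at the identity and the chart `φ`. -/
def cosetCoord (z : EuclideanSpace ℝ (Fin m)) : EuclideanSpace ℝ (Fin n) :=
  φ ((chartOne m G).symm z : G ⧸ H)

variable (m) in
/-- The domain of `cosetCoord`. -/
def cosetDomain : Set (EuclideanSpace ℝ (Fin m)) :=
  (chartOne m G).target ∩ (fun z => ((chartOne m G).symm z : G ⧸ H)) ⁻¹' φ.source

/-- The differential of the projection `G → G ⧸ H` on left invariant fields, in coordinates. -/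
def cosetFrame (z : EuclideanSpace ℝ (Fin m)) :
    EuclideanSpace ℝ (Fin m) →L[ℝ] EuclideanSpace ℝ (Fin n) :=
  (fderiv ℝ (cosetCoord H φ) z).comp (leftFrame m G z)

variable {H φ}

lemma coordOne_mem_cosetDomain (ho : ((1 : G) : G ⧸ H) ∈ φ.source) :
    coordOne m G ∈ cosetDomain m H φ :=
  ⟨coordOne_mem_target, by simpa [chartOne_symm_coordOne] using ho⟩

lemma cosetCoord_coordOne : cosetCoord H φ (coordOne m G) = φ ((1 : G) : G ⧸ H) := by
  simp [cosetCoord]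

lemma cosetCoord_mem_target {z : EuclideanSpace ℝ (Fin m)} (hz : z ∈ cosetDomain m H φ) :
    cosetCoord H φ z ∈ φ.target := φ.map_source hz.2

variable [LieGroup (𝓡 m) ∞ G]

lemma isOpen_cosetDomain : IsOpen (cosetDomain m H φ) := by
  have h : ContinuousOn (fun z => ((chartOne m G).symm z : G ⧸ H)) (chartOne m G).target :=
    QuotientGroup.continuous_mk.comp_continuousOn (chartOne m G).continuousOn_symm
  exact h.isOpen_inter_preimage (chartOne m G).open_target φ.open_source

lemma IsSmoothCosetSpace.contMDiff_mk (hH : IsSmoothCosetSpace m n H) :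
    ContMDiff (𝓡 m) (𝓡 n) ∞ (QuotientGroup.mk : G → G ⧸ H) := hH.submersion.contMDiff

lemma contDiffOn_cosetCoord (hH : IsSmoothCosetSpace m n H)
    (hφ : φ ∈ IsManifold.maximalAtlas (𝓡 n) ∞ (G ⧸ H)) :
    ContDiffOn ℝ ∞ (cosetCoord H φ) (cosetDomain m H φ) := by
  have h1 := hH.contMDiff_mk.comp_contMDiffOn
    (contMDiffOn_symm_of_mem_maximalAtlas (chartOne_mem_maximalAtlas (m := m) (G := G)))
  exact ((contMDiffOn_of_mem_maximalAtlas hφ).comp (h1.mono inter_subset_left)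
    fun z hz => hz.2).contDiffOn

lemma hasFDerivAt_cosetCoord (hH : IsSmoothCosetSpace m n H)
    (hφ : φ ∈ IsManifold.maximalAtlas (𝓡 n) ∞ (G ⧸ H)) {z : EuclideanSpace ℝ (Fin m)}
    (hz : z ∈ cosetDomain m H φ) :
    HasFDerivAt (cosetCoord H φ) (fderiv ℝ (cosetCoord H φ) z) z :=
  (((contDiffOn_cosetCoord hH hφ).contDiffAt (isOpen_cosetDomain.mem_nhds hz)).differentiableAt
    (by simp)).hasFDerivAt

lemma contDiffAt_cosetFrame (hH : IsSmoothCosetSpace m n H)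
    (hφ : φ ∈ IsManifold.maximalAtlas (𝓡 n) ∞ (G ⧸ H)) {z : EuclideanSpace ℝ (Fin m)}
    (hz : z ∈ cosetDomain m H φ) : ContDiffAt ℝ ∞ (cosetFrame H φ) z :=
  (((contDiffOn_cosetCoord hH hφ).contDiffAt (isOpen_cosetDomain.mem_nhds hz)).fderiv_right
    (m := ∞) (by simp)).clm_comp (contDiffAt_leftFrame hz.1)

lemma fderiv_cosetCoord_coordOne (hH : IsSmoothCosetSpace m n H)
    (hφ : φ ∈ IsManifold.maximalAtlas (𝓡 n) ∞ (G ⧸ H)) (ho : ((1 : G) : G ⧸ H) ∈ φ.source)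
    (w : EuclideanSpace ℝ (Fin m)) :
    fderiv ℝ (cosetCoord H φ) (coordOne m G) w = mfderiv (𝓡 n) (𝓡 n) φ ((1 : G) : G ⧸ H)
      (mfderiv (𝓡 m) (𝓡 n) (QuotientGroup.mk : G → G ⧸ H) 1 w) := by
  have hψ := mdifferentiable_of_mem_maximalAtlas (chartOne_mem_maximalAtlas (m := m) (G := G))
  have h1 := (hasFDerivAt_cosetCoord hH hφ (coordOne_mem_cosetDomain ho)).hasMFDerivAt.comp (1 : G)
    (hψ.mdifferentiableAt one_mem_chartOne_source).hasMFDerivAt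
  have h2 := ((mdifferentiable_of_mem_maximalAtlas hφ).mdifferentiableAt ho).hasMFDerivAt.comp
    (1 : G) (hH.contMDiff_mk.mdifferentiableAt (by simp)).hasMFDerivAt
  have h3 : φ ∘ (QuotientGroup.mk : G → G ⧸ H) =ᶠ[𝓝 1] cosetCoord H φ ∘ chartOne m G := by
    filter_upwards [(chartOne m G).open_source.mem_nhds one_mem_chartOne_source] with p hp
    simp only [Function.comp, cosetCoord, (chartOne m G).left_inv hp]
  have h4 : fderiv ℝ (cosetCoord H φ) (coordOne m G)
      (mfderiv (𝓡 m) (𝓡 m) (chartOne m G) 1 w) = mfderiv (𝓡 n) (𝓡 n) φ ((1 : G) : G ⧸ H)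
      (mfderiv (𝓡 m) (𝓡 n) (QuotientGroup.mk : G → G ⧸ H) 1 w) :=
    congrArg (fun L : EuclideanSpace ℝ (Fin m) →L[ℝ] EuclideanSpace ℝ (Fin n) => L w)
      (hasMFDerivAt_unique (h1.congr_of_eventuallyEq h3) h2)
  rw [← h4]
  exact congrArg _ (mfderiv_chartOne_one w).symm

lemma cosetFrame_coordOne_apply (w : EuclideanSpace ℝ (Fin m)) :
    cosetFrame H φ (coordOne m G) w = fderiv ℝ (cosetCoord H φ) (coordOne m G) w := by
  rw [cosetFrame, ContinuousLinearMap.comp_apply, leftFrame_coordOne]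

lemma cosetFrame_coordOne_eq_mfderiv (hH : IsSmoothCosetSpace m n H)
    (hφ : φ ∈ IsManifold.maximalAtlas (𝓡 n) ∞ (G ⧸ H)) (ho : ((1 : G) : G ⧸ H) ∈ φ.source)
    (w : EuclideanSpace ℝ (Fin m)) :
    cosetFrame H φ (coordOne m G) w = mfderiv (𝓡 n) (𝓡 n) φ ((1 : G) : G ⧸ H)
      (mfderiv (𝓡 m) (𝓡 n) (QuotientGroup.mk : G → G ⧸ H) 1 w) := by
  rw [cosetFrame_coordOne_apply, fderiv_cosetCoord_coordOne hH hφ ho]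

lemma stdCoord_toOrigin (hH : IsSmoothCosetSpace m n H)
    (hφ : φ ∈ IsManifold.maximalAtlas (𝓡 n) ∞ (G ⧸ H)) (ho : ((1 : G) : G ⧸ H) ∈ φ.source)
    (w : EuclideanSpace ℝ (Fin m)) :
    stdCoord φ (toOrigin m n H w) =
      (φ ((1 : G) : G ⧸ H), cosetFrame H φ (coordOne m G) w) :=
  Prod.ext rfl (cosetFrame_coordOne_eq_mfderiv hH hφ ho w).symm

/-- A vector killed by the differential of the projection is the velocity of a curve in the fibre
through 1, which is `H`. Conversely, the projection is constant along curves in `H`. -/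
lemma cosetFrame_coordOne_eq_zero_iff (hH : IsSmoothCosetSpace m n H)
    (hφ : φ ∈ IsManifold.maximalAtlas (𝓡 n) ∞ (G ⧸ H)) (ho : ((1 : G) : G ⧸ H) ∈ φ.source)
    (w : EuclideanSpace ℝ (Fin m)) :
    cosetFrame H φ (coordOne m G) w = 0 ↔ IsTangentTo (m := m) H w := by
  rw [cosetFrame_coordOne_eq_mfderiv hH hφ ho]
  constructor
  · intro h
    obtain ⟨F, _, _, hF⟩ := hH.submersion
    have h0 := (mdifferentiable_of_mem_maximalAtlas hφ).mfderiv_injective ho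
      (h.trans (map_zero _).symm)
    obtain ⟨γ, h1, h2, h3, h4⟩ := exists_curve_in_fiber (hF 1) h0
    refine ⟨γ, h1, h2, fun t => ?_, h4⟩
    simpa using QuotientGroup.eq.1 (h3 t).symm
  · rintro ⟨γ, h1, h2, h3, rfl⟩
    have h4 : MDifferentiableAt (𝓡 m) (𝓡 n) (QuotientGroup.mk : G → G ⧸ H) (γ 0) :=
      hH.contMDiff_mk.mdifferentiableAt (by simp)
    have h5 := h4.hasMFDerivAt.comp 0 (h1.mdifferentiableAt (x := (0 : ℝ)) (by simp)).hasMFDerivAt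
    have h6 : (QuotientGroup.mk : G → G ⧸ H) ∘ γ = fun _ => ((1 : G) : G ⧸ H) := by
      funext t
      exact (QuotientGroup.eq.2 (by simpa using h3 t)).symm
    rw [h6] at h5
    have h7 := congrArg (fun L : ℝ →L[ℝ] EuclideanSpace ℝ (Fin n) => L 1)
      (hasMFDerivAt_unique h5 (hasMFDerivAt_const _ _))
    have h8 : ∀ p : G, p = 1 → (mfderiv (𝓡 m) (𝓡 n) (QuotientGroup.mk : G → G ⧸ H) 1 :
        EuclideanSpace ℝ (Fin m) → EuclideanSpace ℝ (Fin n)) =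
        mfderiv (𝓡 m) (𝓡 n) (QuotientGroup.mk : G → G ⧸ H) p := by
      rintro _ rfl
      rfl
    have h9 := (congrFun (h8 (γ 0) h2) (mfderiv 𝓘(ℝ, ℝ) (𝓡 m) γ 0 (1 : ℝ))).trans h7
    exact (congrArg _ h9).trans (map_zero _)

lemma cosetFrame_coordOne_surjective (hH : IsSmoothCosetSpace m n H)
    (hφ : φ ∈ IsManifold.maximalAtlas (𝓡 n) ∞ (G ⧸ H)) (ho : ((1 : G) : G ⧸ H) ∈ φ.source) :
    Function.Surjective (cosetFrame H φ (coordOne m G)) := by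
  intro x
  obtain ⟨F, _, _, hF⟩ := hH.submersion
  obtain ⟨u, hu⟩ := (mdifferentiable_of_mem_maximalAtlas hφ).mfderiv_surjective ho x
  obtain ⟨w, hw⟩ := mfderiv_surjective_of_isSubmersionAt (hF 1) u
  refine ⟨w, (cosetFrame_coordOne_eq_mfderiv hH hφ ho w).trans ?_⟩
  rw [hw, hu]

lemma bijective_cosetFrame_restrict (hH : IsSmoothCosetSpace m n H)
    (hφ : φ ∈ IsManifold.maximalAtlas (𝓡 n) ∞ (G ⧸ H)) (ho : ((1 : G) : G ⧸ H) ∈ φ.source)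
    {𝔪 : Submodule ℝ (EuclideanSpace ℝ (Fin m))} (h𝔪 : IsCompl (subgroupLieAlgebra m H) 𝔪) :
    Function.Bijective fun w : 𝔪 => cosetFrame H φ (coordOne m G) w := by
  constructor
  · intro a b hab
    have h0 : cosetFrame H φ (coordOne m G) (a - b : EuclideanSpace ℝ (Fin m)) = 0 :=
      (map_sub (cosetFrame H φ (coordOne m G)) _ _).trans (sub_eq_zero.2 hab)
    have h1 := (cosetFrame_coordOne_eq_zero_iff hH hφ ho _).1 h0
    have h2 := (Submodule.disjoint_def.1 h𝔪.disjoint) _ h1 (𝔪.sub_mem a.2 b.2)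
    exact Subtype.ext (sub_eq_zero.1 h2)
  · intro x
    obtain ⟨w, hw⟩ := cosetFrame_coordOne_surjective hH hφ ho x
    obtain ⟨a, b, ha, hb, hab⟩ :=
      Submodule.codisjoint_iff_exists_add_eq.1 h𝔪.codisjoint w
    refine ⟨⟨b, hb⟩, ?_⟩
    have h1 := (cosetFrame_coordOne_eq_zero_iff hH hφ ho a).2 ha
    have h2 : cosetFrame H φ (coordOne m G) w =
        cosetFrame H φ (coordOne m G) a + cosetFrame H φ (coordOne m G) b :=
      (congrArg _ hab.symm).trans (map_add (cosetFrame H φ (coordOne m G)) _ _)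
    change cosetFrame H φ (coordOne m G) b = x
    rw [← hw, h2, h1, zero_add]

end CosetCoordinates

/-! ### Smooth integral curves, and lifting a second order equation. -/

section ODE

variable {E F : Type*} [NormedAddCommGroup E] [NormedSpace ℝ E] [CompleteSpace E]
  [NormedAddCommGroup F] [NormedSpace ℝ F] [CompleteSpace F]

lemma exists_contDiffOn_integralCurve {V : E → E} {U : Set E} (hU : IsOpen U)
    (hV : ContDiffOn ℝ ∞ V U) {x : E} (hx : x ∈ U) :
    ∃ ε > (0 : ℝ), ∃ α : ℝ → E, α 0 = x ∧ ContDiffOn ℝ ∞ α (Ioo (-ε) ε) ∧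
      ∀ t ∈ Ioo (-ε) ε, α t ∈ U ∧ HasDerivAt α (V (α t)) t := by
  obtain ⟨α, hα0, ε, hε, hα⟩ :=
    ContDiffAt.exists_forall_mem_closedBall_exists_eq_forall_mem_Ioo_hasDerivAt₀
      ((hV.contDiffAt (hU.mem_nhds hx)).of_le (by simp)) 0
  simp only [zero_sub, zero_add] at hα
  have hc : ContinuousAt α 0 := (hα 0 (by simp [hε])).continuousAt
  obtain ⟨δ, hδ, hball⟩ := Metric.mem_nhds_iff.1
    (hc.preimage_mem_nhds (hU.mem_nhds (hα0.symm ▸ hx)))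
  -- Halving leaves room for the closed interval `[-r, r]`, on which the smoothness bootstrap is
  -- applied, inside both the existence interval and the preimage of `U`.
  set r := min ε δ / 2
  have hr : 0 < r := by positivity
  have hrε : r < ε := (half_lt_self (by positivity)).trans_le (min_le_left _ _)
  have hrδ : r < δ := (half_lt_self (by positivity)).trans_le (min_le_right _ _)
  have h1 : ∀ t ∈ Icc (-r) r, α t ∈ U ∧ HasDerivAt α (V (α t)) t := by
    intro t ht
    refine ⟨hball ?_, hα t ⟨by linarith [ht.1], by linarith [ht.2]⟩⟩
    rw [mem_ball_zero_iff, Real.norm_eq_abs]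
    exact (abs_le.2 ht).trans_lt hrδ
  refine ⟨r, hr, α, hα0, ?_, fun t ht => h1 t (Ioo_subset_Icc_self ht)⟩
  have h2 : ContDiffOn ℝ (⊤ : ℕ∞) α (Icc (-r) r) :=
    ODE.contDiffOn_enat_Icc_of_hasDerivWithinAt (f := fun _ => V) (u := U)
      (hV.comp contDiffOn_snd fun p hp => hp.2)
      (fun t ht => (h1 t ht).2.hasDerivWithinAt) (fun t ht => (h1 t ht).1)
  exact h2.mono Ioo_subset_Icc_self

/-- Expanding `(B(z)u)' = DB(z)(z')u + B(z)u'` and using that `B(z)` is invertible on `W` for `z`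
near `z₀`, the required equation can be solved for `u'`. It becomes a smooth first order system for
`(z, u)` in `E × W`. -/
lemma exists_second_order_lift {D : Set E} (hD : IsOpen D) {q : E → F} {X : E → E →L[ℝ] E}
    {B : E → E →L[ℝ] F} {Γ : F × F → F} {T : Set F}
    (hq : ContDiffOn ℝ ∞ q D) (hX : ContDiffOn ℝ ∞ X D) (hB : ContDiffOn ℝ ∞ B D)
    (hqT : MapsTo q D T) (hΓ : ContDiffOn ℝ ∞ Γ (T ×ˢ {0}ᶜ)) (W : Submodule ℝ E) [CompleteSpace W]
    {z₀ : E} (hz₀ : z₀ ∈ D) (b : W ≃L[ℝ] F) (hb : ∀ w : W, b w = B z₀ w) {y : W} (hy : y ≠ 0) :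
    ∃ ε > (0 : ℝ), ∃ (z : ℝ → E) (u : ℝ → W), z 0 = z₀ ∧ u 0 = y ∧
      ContDiffOn ℝ ∞ z (Ioo (-ε) ε) ∧ ∀ t ∈ Ioo (-ε) ε, z t ∈ D ∧ B (z t) (u t) ≠ 0 ∧
        HasDerivAt z (X (z t) (u t)) t ∧ DifferentiableAt ℝ u t ∧
        HasDerivAt (fun s => B (z s) (u s)) ((-2 : ℝ) • Γ (q (z t), B (z t) (u t))) t := by
  let R : E → W →L[ℝ] F := fun z => (B z).comp W.subtypeL
  have hR : ContDiffOn ℝ ∞ R D := hB.clm_comp contDiffOn_const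
  -- The locus where `B(z)` restricted to `W` is invertible; it is open because invertible operators
  -- form an open set.
  let D' : Set E := D ∩ R ⁻¹' range ((↑) : (W ≃L[ℝ] F) → W →L[ℝ] F)
  have hD' : IsOpen D' := hR.continuousOn.isOpen_inter_preimage hD ContinuousLinearEquiv.isOpen
  let P : E × W → F := fun p => B p.1 (p.2 : E)
  have hP : ContDiffOn ℝ ∞ P (D ×ˢ univ) :=
    (hB.comp contDiffOn_fst fun p hp => hp.1).clm_apply
      (W.subtypeL.contDiff.comp contDiff_snd).contDiffOn
  -- Also remove the zeros of `B(z)u`, where `Γ` need not be smooth.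
  let U : Set (E × W) := (D' ×ˢ univ) ∩ P ⁻¹' {0}ᶜ
  have hU : IsOpen U :=
    (hP.continuousOn.mono (prod_mono inter_subset_left subset_rfl)).isOpen_inter_preimage
      (hD'.prod isOpen_univ) isOpen_compl_singleton
  have hUD : ∀ p ∈ U, p.1 ∈ D := fun p hp => hp.1.1.1
  let V : E × W → E × W := fun p =>
    (X p.1 (p.2 : E), (R p.1).inverse ((-2 : ℝ) • Γ (q p.1, P p) -
      fderiv ℝ B p.1 (X p.1 (p.2 : E)) (p.2 : E)))
  have hsub : ContDiff ℝ ∞ fun p : E × W => (p.2 : E) := W.subtypeL.contDiff.comp contDiff_snd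
  have hX' : ContDiffOn ℝ ∞ (fun p : E × W => X p.1 (p.2 : E)) U :=
    (hX.comp contDiffOn_fst hUD).clm_apply hsub.contDiffOn
  have hinv : ContDiffOn ℝ ∞ (fun p : E × W => (R p.1).inverse) U := by
    intro p hp
    obtain ⟨e, he⟩ := hp.1.1.2
    have h1 : ContDiffAt ℝ ∞ ContinuousLinearMap.inverse (R p.1) := by
      rw [← he]
      exact contDiffAt_map_inverse e
    exact (h1.comp p ((hR.contDiffAt (hD.mem_nhds (hUD p hp))).comp p
      contDiffAt_fst)).contDiffWithinAt
  have hdB : ContDiffOn ℝ ∞ (fderiv ℝ B) D := hB.fderiv_of_isOpen hD (by simp)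
  have hV : ContDiffOn ℝ ∞ V U := by
    refine hX'.prodMk (hinv.clm_apply (ContDiffOn.sub (ContDiffOn.const_smul _ (hΓ.comp
      ((hq.comp contDiffOn_fst hUD).prodMk (hP.mono fun p hp => ⟨hUD p hp, mem_univ _⟩))
      fun p hp => ⟨hqT (hUD p hp), hp.2⟩)) ?_))
    exact ((hdB.comp contDiffOn_fst hUD).clm_apply hX').clm_apply hsub.contDiffOn
  have hmem : (z₀, y) ∈ U := by
    refine ⟨⟨⟨hz₀, b, ?_⟩, mem_univ _⟩, ?_⟩
    · ext w
      exact hb w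
    · change B z₀ y ≠ 0
      rw [← hb]
      simpa using hy
  obtain ⟨ε, hε, α, hα0, hαs, hα⟩ := exists_contDiffOn_integralCurve hU hV hmem
  refine ⟨ε, hε, fun t => (α t).1, fun t => (α t).2, by simp [hα0], by simp [hα0],
    contDiff_fst.comp_contDiffOn hαs, fun t ht => ?_⟩
  obtain ⟨htU, htd⟩ := hα t ht
  have hz : HasDerivAt (fun t => (α t).1) (V (α t)).1 t :=
    (hasFDerivAt_fst (p := α t)).comp_hasDerivAt t htd
  have hu : HasDerivAt (fun t => (α t).2) (V (α t)).2 t :=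
    (hasFDerivAt_snd (p := α t)).comp_hasDerivAt t htd
  refine ⟨hUD _ htU, htU.2, hz, hu.differentiableAt, ?_⟩
  have hBd : HasDerivAt (fun s => B (α s).1) (fderiv ℝ B (α t).1 (V (α t)).1) t :=
    ((hB.contDiffAt (hD.mem_nhds (hUD _ htU))).differentiableAt
      (by simp)).hasFDerivAt.comp_hasDerivAt t hz
  have hu' : HasDerivAt (fun s => ((α s).2 : E)) ((V (α t)).2 : E) t :=
    W.subtypeL.hasFDerivAt.comp_hasDerivAt t hu
  refine (hBd.clm_apply hu').congr_deriv ?_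
  obtain ⟨e, he⟩ := htU.1.1.2
  have h1 : ∀ x, B (α t).1 ((R (α t).1).inverse x : E) = x := by
    intro x
    change R (α t).1 ((R (α t).1).inverse x) = x
    rw [← he]
    simp
  simp only [V, h1]
  simp [P]

end ODE

/-! ### The determinant and its derivative at the identity. -/

section Determinant

variable {V : Type*} [NormedAddCommGroup V] [NormedSpace ℝ V] [FiniteDimensional ℝ V]

lemma contDiff_det : ContDiff ℝ ∞ fun A : V →L[ℝ] V => LinearMap.det (A : V →ₗ[ℝ] V) := by
  let b := Module.finBasis ℝ V
  have h : (fun A : V →L[ℝ] V => LinearMap.det (A : V →ₗ[ℝ] V)) =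
      fun A : V →L[ℝ] V => (LinearMap.toMatrix b b (A : V →ₗ[ℝ] V)).det := by
    funext A
    rw [LinearMap.det_toMatrix]
  rw [h]
  simp only [Matrix.det_apply]
  refine ContDiff.sum fun s _ => ContDiff.const_smul _ (contDiff_prod fun i _ => ?_)
  let L : (V →L[ℝ] V) →ₗ[ℝ] ℝ :=
    { toFun := fun A => LinearMap.toMatrix b b (A : V →ₗ[ℝ] V) (s i) i
      map_add' := fun A A' => by simp
      map_smul' := fun r A => by simp }
  exact L.toContinuousLinearMap.contDiff

/-- The derivative of `det` along a curve depends only on the velocity, so `M` may be replaced by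
the line `id + t A`, where `det(1 + t N) = 1 + t tr N + O(t²)`. -/
lemma hasDerivAt_det_of_eq_id {M : ℝ → V →L[ℝ] V} {A : V →L[ℝ] V} (hM : HasDerivAt M A 0)
    (h0 : M 0 = ContinuousLinearMap.id ℝ V) :
    HasDerivAt (fun t => LinearMap.det (M t : V →ₗ[ℝ] V)) (LinearMap.trace ℝ V A) 0 := by
  have hd := (contDiff_det (V := V)).differentiable (by simp) (ContinuousLinearMap.id ℝ V)
  have h1 : HasDerivAt (fun t : ℝ => ContinuousLinearMap.id ℝ V + t • A) A 0 := by
    simpa using ((hasDerivAt_id (0 : ℝ)).smul_const A).const_add (ContinuousLinearMap.id ℝ V)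
  have h2 := HasFDerivAt.comp_hasDerivAt_of_eq (0 : ℝ) hd.hasFDerivAt h1 (by simp)
  have h3 := HasFDerivAt.comp_hasDerivAt_of_eq (0 : ℝ) hd.hasFDerivAt hM h0.symm
  have h4 : HasDerivAt ((fun A : V →L[ℝ] V => LinearMap.det (A : V →ₗ[ℝ] V)) ∘
      fun t : ℝ => ContinuousLinearMap.id ℝ V + t • A) (LinearMap.trace ℝ V A) 0 := by
    let b := Module.finBasis ℝ V
    set N := LinearMap.toMatrix b b (A : V →ₗ[ℝ] V)
    have h5 : ((fun A : V →L[ℝ] V => LinearMap.det (A : V →ₗ[ℝ] V)) ∘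
        fun t : ℝ => ContinuousLinearMap.id ℝ V + t • A) = fun t : ℝ => (1 + t • N).det := by
      funext t
      rw [Function.comp, ← LinearMap.det_toMatrix b]
      congr 1
      simp [N]
    have h6 : LinearMap.trace ℝ V A = N.trace := LinearMap.trace_eq_matrix_trace ℝ b _
    rw [h5, h6, funext fun t : ℝ => Matrix.det_one_add_smul t N]
    have h7 : ∀ p : Polynomial ℝ, HasDerivAt (fun t : ℝ => 1 + N.trace * t + p.eval t * t ^ 2)
        N.trace 0 := by
      intro p
      have := (((hasDerivAt_id (0 : ℝ)).const_mul N.trace).const_add 1).add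
        ((p.hasDerivAt 0).mul ((hasDerivAt_id (0 : ℝ)).pow 2))
      refine this.congr_deriv ?_
      simp
    exact h7 _
  rw [h2.unique h4] at h3
  exact h3

end Determinant

/-! ### Pointwise comparison of continuous densities, and change of variables. -/

section Densities

variable {F : Type*} [NormedAddCommGroup F] [NormedSpace ℝ F] [FiniteDimensional ℝ F]
  [MeasurableSpace F] [BorelSpace F] (ν : Measure F) [ν.IsAddHaarMeasure]

lemma le_of_forall_setLIntegral_eq {f g : F → ℝ} {x : F} (hf : ContinuousAt f x)
    (hg : ContinuousAt g x) (hf0 : 0 ≤ f x) {U : Set F} (hU : U ∈ 𝓝 x)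
    (h : ∀ A, MeasurableSet A → A ⊆ U →
      ∫⁻ z in A, ENNReal.ofReal (f z) ∂ν = ∫⁻ z in A, ENNReal.ofReal (g z) ∂ν) :
    g x ≤ f x := by
  by_contra! hlt
  -- With `f x < c < d < g x`, on a small ball the integral of `f` is at most `c` times its volume
  -- and that of `g` at least `d` times it. The volume is positive and finite, which is a
  -- contradiction.
  obtain ⟨c, hc1, hc2⟩ := exists_between hlt
  obtain ⟨d, hd1, hd2⟩ := exists_between hc2
  have hev := (hf.eventually_lt_const hc1).and ((hg.eventually_const_lt hd2).and hU)
  obtain ⟨r, hr, hball⟩ := Metric.mem_nhds_iff.1 hev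
  have hA : MeasurableSet (Metric.ball x r) := Metric.isOpen_ball.measurableSet
  have h1 : ∫⁻ z in Metric.ball x r, ENNReal.ofReal (f z) ∂ν ≤
      ENNReal.ofReal c * ν (Metric.ball x r) := by
    rw [← setLIntegral_const]
    exact setLIntegral_mono' hA fun z hz => ENNReal.ofReal_le_ofReal (hball hz).1.le
  have h2 : ENNReal.ofReal d * ν (Metric.ball x r) ≤
      ∫⁻ z in Metric.ball x r, ENNReal.ofReal (g z) ∂ν := by
    rw [← setLIntegral_const]
    exact setLIntegral_mono' hA fun z hz => ENNReal.ofReal_le_ofReal (hball hz).2.1.le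
  have h3 := h2.trans ((h _ hA fun z hz => (hball hz).2.2).symm.le.trans h1)
  rw [ENNReal.mul_le_mul_iff_left (Metric.measure_ball_pos ν x hr).ne' measure_ball_lt_top.ne] at h3
  have h4 := (ENNReal.ofReal_le_ofReal_iff (by linarith)).1 h3
  linarith

lemma eq_of_forall_setLIntegral_eq {f g : F → ℝ} {x : F} (hf : ContinuousAt f x)
    (hg : ContinuousAt g x) (hf0 : 0 ≤ f x) (hg0 : 0 ≤ g x) {U : Set F} (hU : U ∈ 𝓝 x)
    (h : ∀ A, MeasurableSet A → A ⊆ U →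
      ∫⁻ z in A, ENNReal.ofReal (f z) ∂ν = ∫⁻ z in A, ENNReal.ofReal (g z) ∂ν) :
    f x = g x :=
  le_antisymm (le_of_forall_setLIntegral_eq ν hg hf hg0 hU fun A hA hAU => (h A hA hAU).symm)
    (le_of_forall_setLIntegral_eq ν hf hg hf0 hU h)

/-- By the change of variables formula both sides are continuous densities with the same integral
over every measurable subset of `U`. -/
lemma density_eq_abs_det_mul {σ : F → ℝ} {h : F → F} {U T : Set F} {x : F} (hU : IsOpen U)
    (hx : x ∈ U) (hT : IsOpen T) (hσ : ContinuousOn σ T) (hσ0 : ∀ z ∈ T, 0 < σ z) (hUT : U ⊆ T)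
    (hh : ContDiffOn ℝ 1 h U) (hhT : MapsTo h U T) (hinj : InjOn h U)
    (heq : ∀ A, MeasurableSet A → A ⊆ U →
      ∫⁻ z in A, ENNReal.ofReal (σ z) ∂ν = ∫⁻ z in h '' A, ENNReal.ofReal (σ z) ∂ν) :
    σ x = |LinearMap.det (fderiv ℝ h x : F →ₗ[ℝ] F)| * σ (h x) := by
  have hd : ∀ z ∈ U, HasFDerivAt h (fderiv ℝ h z) z := fun z hz =>
    ((hh.contDiffAt (hU.mem_nhds hz)).differentiableAt (by simp)).hasFDerivAt
  have hdet : ContinuousAt (fun z => |LinearMap.det (fderiv ℝ h z : F →ₗ[ℝ] F)| * σ (h z)) x := by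
    have h1 : ContinuousAt (fderiv ℝ h) x :=
      ((hh.contDiffAt (hU.mem_nhds hx)).fderiv_right (m := 0) (by simp)).continuousAt
    have h2 : ContinuousAt (fun z => LinearMap.det (fderiv ℝ h z : F →ₗ[ℝ] F)) x :=
      (contDiff_det (V := F)).continuous.continuousAt.comp h1
    exact h2.abs.mul (ContinuousAt.comp (hσ.continuousAt (hT.mem_nhds (hhT hx)))
      (hd x hx).continuousAt)
  refine eq_of_forall_setLIntegral_eq ν (hσ.continuousAt (hT.mem_nhds (hUT hx))) hdet
    (hσ0 _ (hUT hx)).le (mul_nonneg (abs_nonneg _) (hσ0 _ (hhT hx)).le) (hU.mem_nhds hx)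
    fun A hA hAU => ?_
  rw [heq A hA hAU, lintegral_image_eq_lintegral_abs_det_fderiv_mul ν hA
    (fun z hz => (hd z (hAU hz)).hasFDerivWithinAt) (hinj.mono hAU)]
  refine lintegral_congr fun z => ?_
  rw [ENNReal.ofReal_mul (abs_nonneg _)]

end Densities

/-! ### The spray vector field in coordinates, and its existence. -/

section SprayVectors

variable {m n : ℕ} {G : Type*} [TopologicalSpace G] [ChartedSpace (EuclideanSpace ℝ (Fin m)) G]
  [Group G] [LieGroup (𝓡 m) ∞ G] {H : Subgroup G} [ChartedSpace (EuclideanSpace ℝ (Fin n)) (G ⧸ H)]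
  {φ : OpenPartialHomeomorph (G ⧸ H) (EuclideanSpace ℝ (Fin n))}
  [IsManifold (𝓡 n) ∞ (G ⧸ H)] {S : Spray n (G ⧸ H)}
  {𝔪 : Submodule ℝ (EuclideanSpace ℝ (Fin m))}

/-- The coordinate velocity of the geodesic is `B(z)u`. Differentiating it at 0 by the product rule,
with `z'(0) = y` and `u'(0) = -v`, and comparing with the geodesic equation gives the formula. -/
lemma IsSprayVector.cosetFrame_apply (hH : IsSmoothCosetSpace m n H)
    (hφ : φ ∈ IsManifold.maximalAtlas (𝓡 n) ∞ (G ⧸ H)) (ho : ((1 : G) : G ⧸ H) ∈ φ.source)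
    (h𝔪 : IsCompl (subgroupLieAlgebra m H) 𝔪) {y v : 𝔪}
    (hv : IsSprayVector (m := m) (G := G) S 𝔪 y v) :
    cosetFrame H φ (coordOne m G) v =
      (2 : ℝ) • coeff S.toFun φ (φ ((1 : G) : G ⧸ H)) (cosetFrame H φ (coordOne m G) y) +
        fderiv ℝ (cosetFrame H φ) (coordOne m G) y y := by
  obtain ⟨ε, hε, c, cbar, (u : ℝ → 𝔪), hgeo, h0, hcbar, hcbar0, hall, hu⟩ := hv
  have h0s : (0 : ℝ) ∈ Ioo (-ε) ε := by simp [hε]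
  have hs : Ioo (-ε) ε ∈ 𝓝 (0 : ℝ) := Ioo_mem_nhds (by simpa using hε) hε
  have hc0 : c 0 = ((1 : G) : G ⧸ H) := by rw [(hall 0 h0s).1, hcbar0]
  have hcbard : ∀ t ∈ Ioo (-ε) ε, MDifferentiableAt 𝓘(ℝ, ℝ) (𝓡 m) cbar t := fun t ht =>
    (hcbar.contMDiffAt (isOpen_Ioo.mem_nhds ht)).mdifferentiableAt (by simp)
  have hcd : MDifferentiableAt 𝓘(ℝ, ℝ) (𝓡 n) c 0 :=
    (hgeo.1.contMDiffAt hs).mdifferentiableAt (by simp)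
  let z : ℝ → EuclideanSpace ℝ (Fin m) := chartOne m G ∘ cbar
  have hz0 : z 0 = coordOne m G := congrArg (chartOne m G) hcbar0
  have hsrc : ∀ᶠ t in 𝓝 0, t ∈ Ioo (-ε) ε ∧ cbar t ∈ (chartOne m G).source := by
    refine (eventually_mem_set.2 hs).and ?_
    refine (hcbard 0 h0s).continuousAt.preimage_mem_nhds ((chartOne m G).open_source.mem_nhds ?_)
    rw [hcbar0]
    exact one_mem_chartOne_source
  have hzd : ∀ᶠ t in 𝓝 0, HasDerivAt z (leftFrame m G (z t) (u t : EuclideanSpace ℝ (Fin m))) t := by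
    filter_upwards [hsrc] with t ht
    exact (velocity_eq_mulInvariantVectorField_iff (hcbard t ht.1) ht.2 _).1 (hall t ht.1).2.1
  have hzD : ∀ᶠ t in 𝓝 0, z t ∈ cosetDomain m H φ := by
    refine hzd.self_of_nhds.continuousAt.preimage_mem_nhds (isOpen_cosetDomain.mem_nhds ?_)
    rw [hz0]
    exact coordOne_mem_cosetDomain ho
  have hcz : φ ∘ c =ᶠ[𝓝 0] cosetCoord H φ ∘ z := by
    filter_upwards [hsrc] with t ht
    simp only [Function.comp, cosetCoord, z, (chartOne m G).left_inv ht.2, (hall t ht.1).1]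
  have hderiv : deriv (φ ∘ c) =ᶠ[𝓝 0]
      fun t => cosetFrame H φ (z t) (u t : EuclideanSpace ℝ (Fin m)) := by
    filter_upwards [hcz.eventuallyEq_nhds, hzd, hzD] with t h1 h2 h3
    rw [h1.deriv_eq]
    exact ((hasFDerivAt_cosetCoord hH hφ h3).comp_hasDerivAt t h2).deriv
  have hderiv0 : deriv (φ ∘ c) 0 = cosetFrame H φ (coordOne m G) (u 0) := by
    refine hderiv.self_of_nhds.trans ?_
    simp only [hz0]
  -- The definition prescribes only the projection of `u 0` to the coset space; injectivity of
  -- `B(z₀)` on `𝔪` recovers `u 0` itself.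
  have hu0 : u 0 = y := by
    have h1 := congrArg (stdCoord φ) h0
    rw [stdCoord_velocity hφ hcd (by rwa [hc0])] at h1
    have h2 : deriv (φ ∘ c) 0 = cosetFrame H φ (coordOne m G) y :=
      (congrArg Prod.snd h1).trans (congrArg Prod.snd (stdCoord_toOrigin hH hφ ho y))
    rw [hderiv0] at h2
    exact (bijective_cosetFrame_restrict hH hφ ho h𝔪).1 h2
  have hsecond := hgeo.hasDerivAt_deriv hφ isOpen_Ioo h0s (by rwa [hc0])
  rw [hderiv0, hu0, hc0] at hsecond
  have hu' : HasDerivAt (fun t => (u t : EuclideanSpace ℝ (Fin m)))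
      (-(v : EuclideanSpace ℝ (Fin m))) 0 := 𝔪.subtypeL.hasFDerivAt.comp_hasDerivAt 0 hu
  have hzd0 := hzd.self_of_nhds
  rw [hz0, hu0, leftFrame_coordOne] at hzd0
  have hB : HasFDerivAt (cosetFrame H φ) (fderiv ℝ (cosetFrame H φ) (coordOne m G)) (z 0) := by
    rw [hz0]
    exact ((contDiffAt_cosetFrame hH hφ (coordOne_mem_cosetDomain ho)).differentiableAt
      (by simp)).hasFDerivAt
  have hprod := (hB.comp_hasDerivAt 0 hzd0).clm_apply hu'
  have heq := (hderiv.hasDerivAt_iff.1 hsecond).unique hprod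
  simp only [Function.comp, hz0, hu0, map_neg] at heq
  rw [neg_smul, neg_eq_iff_eq_neg] at heq
  rw [heq]
  abel

/-- The lift is constructed before the geodesic: solve for `(z, u)` with `z' = L(z)u` and `B(z)u`
obeying the geodesic equation, then project `z`. -/
lemma exists_isSprayVector (hH : IsSmoothCosetSpace m n H)
    (hφ : φ ∈ IsManifold.maximalAtlas (𝓡 n) ∞ (G ⧸ H)) (ho : ((1 : G) : G ⧸ H) ∈ φ.source)
    (h𝔪 : IsCompl (subgroupLieAlgebra m H) 𝔪) {y : 𝔪} (hy : y ≠ 0) :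
    ∃ v : 𝔪, IsSprayVector (m := m) (G := G) S 𝔪 y v := by
  let b : 𝔪 ≃L[ℝ] EuclideanSpace ℝ (Fin n) := (LinearEquiv.ofBijective
    (((cosetFrame H φ (coordOne m G)).comp 𝔪.subtypeL : 𝔪 →L[ℝ] EuclideanSpace ℝ (Fin n)) :
      𝔪 →ₗ[ℝ] EuclideanSpace ℝ (Fin n))
    (bijective_cosetFrame_restrict hH hφ ho h𝔪)).toContinuousLinearEquiv
  obtain ⟨ε, hε, z, u, hz0, hu0, hzs, hall⟩ := exists_second_order_lift isOpen_cosetDomain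
    (contDiffOn_cosetCoord hH hφ)
    (fun z hz => (contDiffAt_leftFrame (G := G) (inter_subset_left hz)).contDiffWithinAt)
    (fun z hz => (contDiffAt_cosetFrame hH hφ hz).contDiffWithinAt)
    (fun z hz => cosetCoord_mem_target hz) (contDiffOn_coeff hφ S) 𝔪
    (coordOne_mem_cosetDomain ho) b (fun w => rfl) hy
  have h0s : (0 : ℝ) ∈ Ioo (-ε) ε := by simp [hε]
  have hx : ∀ t ∈ Ioo (-ε) ε, HasDerivAt (cosetCoord H φ ∘ z)
      (cosetFrame H φ (z t) (u t : EuclideanSpace ℝ (Fin m))) t := fun t ht =>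
    (hasFDerivAt_cosetCoord hH hφ (hall t ht).1).comp_hasDerivAt t (hall t ht).2.2.1
  have hxt : ∀ t ∈ Ioo (-ε) ε, (cosetCoord H φ ∘ z) t ∈ φ.target := fun t ht =>
    cosetCoord_mem_target (hall t ht).1
  have hcbar : ContMDiffOn 𝓘(ℝ, ℝ) (𝓡 m) ∞ ((chartOne m G).symm ∘ z) (Ioo (-ε) ε) :=
    (contMDiffOn_symm_of_mem_maximalAtlas (chartOne_mem_maximalAtlas (m := m) (G := G))).comp
      hzs.contMDiffOn fun t ht => (hall t ht).1.1
  refine ⟨-deriv u 0, ε, hε, φ.symm ∘ (cosetCoord H φ ∘ z), (chartOne m G).symm ∘ z, u,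
    Spray.isGeodesicOn_chart_symm_comp hφ isOpen_Ioo
      ((contDiffOn_cosetCoord hH hφ).comp hzs fun t ht => (hall t ht).1) hxt hx
      (fun t ht => (hall t ht).2.1) (fun t ht => (hall t ht).2.2.2.2), ?_, hcbar, ?_,
    fun t ht => ⟨?_, ?_, ?_⟩, ?_⟩
  · have h1 : (toOrigin m n H (y : EuclideanSpace ℝ (Fin m)) : TangentBundle (𝓡 n) (G ⧸ H)).1 ∈ φ.source := ho
    have h2 := stdCoordSymm_stdCoord hφ h1
    have h3 := stdCoord_toOrigin hH hφ ho (y : EuclideanSpace ℝ (Fin m))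
    rw [← h2]
    have h4 : (cosetCoord H φ ∘ z) 0 = φ ((1 : G) : G ⧸ H) := by
      rw [Function.comp, hz0, cosetCoord_coordOne]
    have h5 : cosetFrame H φ (z 0) (u 0 : EuclideanSpace ℝ (Fin m)) =
        cosetFrame H φ (coordOne m G) (y : EuclideanSpace ℝ (Fin m)) := by rw [hz0, hu0]
    have h6 : (⟨(φ.symm ∘ (cosetCoord H φ ∘ z)) 0,
        velocity n (φ.symm ∘ (cosetCoord H φ ∘ z)) 0⟩ : TangentBundle (𝓡 n) (G ⧸ H)) =
        stdCoordSymm φ ((cosetCoord H φ ∘ z) 0) (cosetFrame H φ (z 0) (u 0)) :=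
      Bundle.TotalSpace.ext rfl
        (heq_of_eq (velocity_chart_symm_comp hφ (hx 0 h0s) (hxt 0 h0s)))
    rw [h6, h4, h5]
    exact (congrArg₂ (stdCoordSymm φ) (congrArg Prod.fst h3) (congrArg Prod.snd h3)).symm
  · rw [Function.comp, hz0, chartOne_symm_coordOne]
  · exact φ.left_inv (hall t ht).1.2
  · have h1 := (hall t ht).1.1
    refine (velocity_eq_mulInvariantVectorField_iff
      ((hcbar.contMDiffAt (isOpen_Ioo.mem_nhds ht)).mdifferentiableAt (by simp))
      ((chartOne m G).map_target h1) _).2 ?_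
    have h2 : chartOne m G ∘ ((chartOne m G).symm ∘ z) =ᶠ[𝓝 t] z := by
      filter_upwards [isOpen_Ioo.mem_nhds ht] with r hr
      exact (chartOne m G).right_inv (hall r hr).1.1
    have h3 : chartOne m G (((chartOne m G).symm ∘ z) t) = z t := (chartOne m G).right_inv h1
    rw [h3]
    exact h2.hasDerivAt_iff.2 (hall t ht).2.2.1
  · intro h
    apply (hall t ht).2.1
    have h1 : (u t : EuclideanSpace ℝ (Fin m)) = 0 := congrArg Subtype.val h
    rw [h1, map_zero]
  · have h1 := (hall 0 h0s).2.2.2.1.hasDerivAt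
    exact h1.congr_deriv (neg_neg _).symm

/-- Existence makes the chosen value a spray vector. The formula holds for every spray vector, so
the choice is immaterial. The variable `v` names the value as an element of `𝔪` viewed in the
Euclidean model rather than in `GroupLieAlgebra`. -/
lemma cosetFrame_sprayVectorField (hH : IsSmoothCosetSpace m n H)
    (hφ : φ ∈ IsManifold.maximalAtlas (𝓡 n) ∞ (G ⧸ H)) (ho : ((1 : G) : G ⧸ H) ∈ φ.source)
    (h𝔪 : IsCompl (subgroupLieAlgebra m H) 𝔪) {y v : 𝔪} (hy : y ≠ 0)
    (hv : sprayVectorField (m := m) (G := G) S 𝔪 y = v) :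
    cosetFrame H φ (coordOne m G) v =
      (2 : ℝ) • coeff S.toFun φ (φ ((1 : G) : G ⧸ H)) (cosetFrame H φ (coordOne m G) y) +
        fderiv ℝ (cosetFrame H φ) (coordOne m G) y y := by
  refine IsSprayVector.cosetFrame_apply hH hφ ho h𝔪 ?_
  rw [← hv]
  exact Classical.epsilon_spec (exists_isSprayVector hH hφ ho h𝔪 hy)

end SprayVectors

/-! ### The connection operator transported to the chart. -/

section ConnectionOperator

/-- The relation can be differentiated at `y ≠ 0` because it holds in a neighbourhood. Both `β w y`
and `β y w` occur since `β` is not assumed symmetric. -/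
lemma apply_fderiv_of_quadratic {W F : Type*} [NormedAddCommGroup W] [NormedSpace ℝ W]
    [NormedAddCommGroup F] [NormedSpace ℝ F] {f : W → W} {b : W ≃L[ℝ] F} {γ : F → F}
    {β : W →L[ℝ] W →L[ℝ] F} (hf : ∀ w, w ≠ 0 → b (f w) = (2 : ℝ) • γ (b w) + β w w) {y : W}
    (hy : y ≠ 0) (hγ : DifferentiableAt ℝ γ (b y)) (w : W) :
    b (fderiv ℝ f y w) = (2 : ℝ) • fderiv ℝ γ (b y) (b w) + (β w y + β y w) := by
  have h1 : HasFDerivAt (fun w => (2 : ℝ) • γ (b w) + β w w)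
      ((2 : ℝ) • (fderiv ℝ γ (b y)).comp (b : W →L[ℝ] F) + ((β y).comp (.id ℝ W) + β.flip y)) y :=
    ((hγ.hasFDerivAt.comp y b.hasFDerivAt).const_smul 2).add
      (β.hasFDerivAt.clm_apply (hasFDerivAt_id y))
  have h2 : f =ᶠ[𝓝 y] b.symm ∘ fun w => (2 : ℝ) • γ (b w) + β w w := by
    filter_upwards [isOpen_ne.mem_nhds hy] with w hw
    simp [← hf w hw]
  rw [((b.symm.hasFDerivAt.comp y h1).congr_of_eventuallyEq h2).fderiv]
  simp [add_comm]

variable {m n : ℕ} {G : Type*} [TopologicalSpace G] [ChartedSpace (EuclideanSpace ℝ (Fin m)) G]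
  [Group G] [LieGroup (𝓡 m) ∞ G] {H : Subgroup G} [ChartedSpace (EuclideanSpace ℝ (Fin n)) (G ⧸ H)]
  {φ : OpenPartialHomeomorph (G ⧸ H) (EuclideanSpace ℝ (Fin n))}

lemma adM_sub_bracket_mem {𝔪 : Submodule ℝ (GroupLieAlgebra (𝓡 m) G)}
    (h𝔪 : IsCompl (subgroupLieAlgebra m H) 𝔪) (y w : 𝔪) :
    IsTangentTo H ((adM h𝔪 y w : GroupLieAlgebra (𝓡 m) G) -
      ⁅(y : GroupLieAlgebra (𝓡 m) G), (w : GroupLieAlgebra (𝓡 m) G)⁆) := by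
  have h : 𝔪.projectionOnto (subgroupLieAlgebra m H) h𝔪.symm
      ((adM h𝔪 y w : GroupLieAlgebra (𝓡 m) G) -
        ⁅(y : GroupLieAlgebra (𝓡 m) G), (w : GroupLieAlgebra (𝓡 m) G)⁆) = 0 := by
    rw [map_sub, Submodule.projectionOnto_apply_left]
    exact sub_self _
  exact (Submodule.projectionOnto_apply_eq_zero_iff _).1 h

lemma fderiv_cosetFrame_apply (hH : IsSmoothCosetSpace m n H)
    (hφ : φ ∈ IsManifold.maximalAtlas (𝓡 n) ∞ (G ⧸ H)) (ho : ((1 : G) : G ⧸ H) ∈ φ.source)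
    (v w : EuclideanSpace ℝ (Fin m)) :
    fderiv ℝ (cosetFrame H φ) (coordOne m G) v w =
      fderiv ℝ (cosetCoord H φ) (coordOne m G) (fderiv ℝ (leftFrame m G) (coordOne m G) v w) +
        fderiv ℝ (fderiv ℝ (cosetCoord H φ)) (coordOne m G) v w := by
  have h1 : DifferentiableAt ℝ (fderiv ℝ (cosetCoord H φ)) (coordOne m G) :=
    (((contDiffOn_cosetCoord hH hφ).contDiffAt (isOpen_cosetDomain.mem_nhds
      (coordOne_mem_cosetDomain ho))).fderiv_right (m := ∞) (by simp)).differentiableAt (by simp)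
  have h2 : DifferentiableAt ℝ (leftFrame m G) (coordOne m G) :=
    (contDiffAt_leftFrame coordOne_mem_target).differentiableAt (by simp)
  have h3 : fderiv ℝ (cosetFrame H φ) (coordOne m G) = _ :=
    (h1.hasFDerivAt.clm_comp h2.hasFDerivAt).fderiv
  rw [h3]
  simp [leftFrame_coordOne]

/-- By the product rule `DB(v)w = Dq(DL(v)w) + D²q(v, w)`, and the symmetric second derivative
cancels on antisymmetrizing. -/
lemma fderiv_cosetFrame_sub_fderiv_cosetFrame (hH : IsSmoothCosetSpace m n H)
    (hφ : φ ∈ IsManifold.maximalAtlas (𝓡 n) ∞ (G ⧸ H)) (ho : ((1 : G) : G ⧸ H) ∈ φ.source)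
    (v w : EuclideanSpace ℝ (Fin m)) :
    fderiv ℝ (cosetFrame H φ) (coordOne m G) v w - fderiv ℝ (cosetFrame H φ) (coordOne m G) w v =
      cosetFrame H φ (coordOne m G)
        (fderiv ℝ (leftFrame m G) (coordOne m G) v w -
          fderiv ℝ (leftFrame m G) (coordOne m G) w v) := by
  have hsymm : IsSymmSndFDerivAt ℝ (cosetCoord H φ) (coordOne m G) :=
    ((contDiffOn_cosetCoord hH hφ).contDiffAt (isOpen_cosetDomain.mem_nhds
      (coordOne_mem_cosetDomain ho))).isSymmSndFDerivAt (by
      rw [minSmoothness_of_isRCLikeNormedField]; exact ENat.LEInfty.out)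
  rw [fderiv_cosetFrame_apply hH hφ ho, fderiv_cosetFrame_apply hH hφ ho, hsymm v w,
    cosetFrame_coordOne_apply, map_sub]
  abel

variable {𝔪 : Submodule ℝ (EuclideanSpace ℝ (Fin m))}

/-- Projecting the bracket to `𝔪` changes it by an element of `𝔥`, which `B(z₀)` kills. -/
lemma cosetFrame_adM (hH : IsSmoothCosetSpace m n H)
    (hφ : φ ∈ IsManifold.maximalAtlas (𝓡 n) ∞ (G ⧸ H)) (ho : ((1 : G) : G ⧸ H) ∈ φ.source)
    (h𝔪 : IsCompl (subgroupLieAlgebra m H) 𝔪) {y w v : 𝔪} (hv : adM (G := G) h𝔪 y w = v) :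
    cosetFrame H φ (coordOne m G) v =
      fderiv ℝ (cosetFrame H φ) (coordOne m G) y w -
        fderiv ℝ (cosetFrame H φ) (coordOne m G) w y := by
  rw [fderiv_cosetFrame_sub_fderiv_cosetFrame hH hφ ho, ← sub_eq_zero, ← map_sub]
  refine (cosetFrame_coordOne_eq_zero_iff hH hφ ho _).2 ?_
  have h1 := adM_sub_bracket_mem (G := G) h𝔪 y w
  rw [bracket_eq_fderiv_leftFrame, hv] at h1
  exact h1

variable (𝔪) in
/-- The identification `𝔪 = T_o(G ⧸ H)`, in the chart `φ`. -/
def cosetFrameEquiv (hH : IsSmoothCosetSpace m n H)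
    (hφ : φ ∈ IsManifold.maximalAtlas (𝓡 n) ∞ (G ⧸ H)) (ho : ((1 : G) : G ⧸ H) ∈ φ.source)
    (h𝔪 : IsCompl (subgroupLieAlgebra m H) 𝔪) : 𝔪 ≃L[ℝ] EuclideanSpace ℝ (Fin n) :=
  (LinearEquiv.ofBijective
    (((cosetFrame H φ (coordOne m G)).comp 𝔪.subtypeL : 𝔪 →L[ℝ] EuclideanSpace ℝ (Fin n)) :
      𝔪 →ₗ[ℝ] EuclideanSpace ℝ (Fin n))
    (bijective_cosetFrame_restrict hH hφ ho h𝔪)).toContinuousLinearEquiv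

lemma cosetFrameEquiv_apply (hH : IsSmoothCosetSpace m n H)
    (hφ : φ ∈ IsManifold.maximalAtlas (𝓡 n) ∞ (G ⧸ H)) (ho : ((1 : G) : G ⧸ H) ∈ φ.source)
    (h𝔪 : IsCompl (subgroupLieAlgebra m H) 𝔪) (w : 𝔪) :
    cosetFrameEquiv 𝔪 hH hφ ho h𝔪 w = cosetFrame H φ (coordOne m G) w := rfl

variable [IsManifold (𝓡 n) ∞ (G ⧸ H)] {S : Spray n (G ⧸ H)}

lemma differentiableAt_coeff (hφ : φ ∈ IsManifold.maximalAtlas (𝓡 n) ∞ (G ⧸ H))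
    {x y : EuclideanSpace ℝ (Fin n)} (hx : x ∈ φ.target) (hy : y ≠ 0) :
    DifferentiableAt ℝ (coeff S.toFun φ x) y := by
  have h1 := ((contDiffOn_coeff hφ S).contDiffAt (x := (x, y))
    ((φ.open_target.prod isOpen_compl_singleton).mem_nhds ⟨hx, hy⟩)).differentiableAt (by simp)
  exact h1.comp y ((differentiableAt_const x).prodMk differentiableAt_id :
    DifferentiableAt ℝ (fun s => (x, s)) y)

lemma cosetFrame_fderiv_sprayVectorField (hH : IsSmoothCosetSpace m n H)
    (hφ : φ ∈ IsManifold.maximalAtlas (𝓡 n) ∞ (G ⧸ H)) (ho : ((1 : G) : G ⧸ H) ∈ φ.source)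
    (h𝔪 : IsCompl (subgroupLieAlgebra m H) 𝔪) {y : 𝔪} (hy : y ≠ 0) {f : 𝔪 → 𝔪}
    (hf : sprayVectorField (m := m) (G := G) S 𝔪 = f) (w : 𝔪) :
    cosetFrame H φ (coordOne m G) (fderiv ℝ f y w) =
      (2 : ℝ) • fderiv ℝ (coeff S.toFun φ (φ ((1 : G) : G ⧸ H)))
          (cosetFrame H φ (coordOne m G) y) (cosetFrame H φ (coordOne m G) w) +
        (fderiv ℝ (cosetFrame H φ) (coordOne m G) w y +
          fderiv ℝ (cosetFrame H φ) (coordOne m G) y w) := by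
  let b := cosetFrameEquiv 𝔪 hH hφ ho h𝔪
  let β : 𝔪 →L[ℝ] 𝔪 →L[ℝ] EuclideanSpace ℝ (Fin n) :=
    (fderiv ℝ (cosetFrame H φ) (coordOne m G)).bilinearComp 𝔪.subtypeL 𝔪.subtypeL
  refine apply_fderiv_of_quadratic (b := b) (β := β) (fun w hw => ?_) hy ?_ w
  · exact cosetFrame_sprayVectorField hH hφ ho h𝔪 hw (congrFun hf w)
  · refine differentiableAt_coeff hφ (φ.map_source ho) ?_
    simpa using hy

/-- `N + ad_𝔪` is half of `Dη` plus half of `ad_𝔪`: the symmetric and antisymmetric parts of `DB`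
combine to `DB(y)w`, and `DB(w)y` drops out. -/
lemma cosetFrame_connectionOperator_add_adM (hH : IsSmoothCosetSpace m n H)
    (hφ : φ ∈ IsManifold.maximalAtlas (𝓡 n) ∞ (G ⧸ H)) (ho : ((1 : G) : G ⧸ H) ∈ φ.source)
    (h𝔪 : IsCompl (subgroupLieAlgebra m H) 𝔪) {y : 𝔪} (hy : y ≠ 0) {w v : 𝔪}
    (hv : (connectionOperator (G := G) S h𝔪 y + adM (G := G) h𝔪 y) w = v) :
    cosetFrame H φ (coordOne m G) v =
      fderiv ℝ (coeff S.toFun φ (φ ((1 : G) : G ⧸ H)))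
          (cosetFrame H φ (coordOne m G) y) (cosetFrame H φ (coordOne m G) w) +
        fderiv ℝ (cosetFrame H φ) (coordOne m G) y w := by
  obtain ⟨f, hf⟩ : ∃ f : 𝔪 → 𝔪, sprayVectorField (m := m) (G := G) S 𝔪 = f := ⟨_, rfl⟩
  obtain ⟨a, ha⟩ : ∃ a : 𝔪, adM (G := G) h𝔪 y w = a := ⟨_, rfl⟩
  have h1 : v = (1 / 2 : ℝ) • fderiv ℝ f y w - (1 / 2 : ℝ) • a + a := by
    rw [← hv, ← hf, ← ha]
    rfl
  have h2 : (v : EuclideanSpace ℝ (Fin m)) =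
      (1 / 2 : ℝ) • (fderiv ℝ f y w : EuclideanSpace ℝ (Fin m)) -
        (1 / 2 : ℝ) • (a : EuclideanSpace ℝ (Fin m)) + a := by rw [h1]; rfl
  rw [h2, map_add, map_sub, map_smul, map_smul,
    cosetFrame_fderiv_sprayVectorField hH hφ ho h𝔪 hy hf, cosetFrame_adM hH hφ ho h𝔪 ha]
  module

end ConnectionOperator

/-! ### Invariance of the measure as a Jacobian identity for its density. -/

section InvariantMeasure

variable {n : ℕ} {G : Type*} [TopologicalSpace G] [Group G] {H : Subgroup G}
  [ChartedSpace (EuclideanSpace ℝ (Fin n)) (G ⧸ H)]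
  {φ : OpenPartialHomeomorph (G ⧸ H) (EuclideanSpace ℝ (Fin n))}

variable (φ) in
/-- The action of `g` on `G ⧸ H` in the chart `φ`. -/
def chartSMul (g : G) (x : EuclideanSpace ℝ (Fin n)) : EuclideanSpace ℝ (Fin n) :=
  φ (g • φ.symm x)

variable [IsTopologicalGroup G] [MeasurableSpace (G ⧸ H)] [BorelSpace (G ⧸ H)] {μ : Measure (G ⧸ H)}
  {σ : EuclideanSpace ℝ (Fin n) → ℝ}

lemma measure_smul_image (hinv : ∀ g : G, μ.map (fun x : G ⧸ H => g • x) = μ) (g : G)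
    (A : Set (G ⧸ H)) : μ ((fun x => g • x) '' A) = μ A := by
  have h := (Homeomorph.smul (α := G ⧸ H) g).toMeasurableEquiv.map_apply (μ := μ)
    ((fun x => g • x) '' A)
  have h2 : (Homeomorph.smul (α := G ⧸ H) g).toMeasurableEquiv ⁻¹' ((fun x => g • x) '' A) = A :=
    (MulAction.injective g).preimage_image A
  rw [h2] at h
  rw [← h]
  exact congrArg (fun ν : Measure (G ⧸ H) => ν _) (hinv g).symm

lemma density_eq_abs_det_chartSMul_mul (hσ : IsDensityInChart μ φ σ)
    (hinv : ∀ g : G, μ.map (fun x : G ⧸ H => g • x) = μ) {g : G} {x : EuclideanSpace ℝ (Fin n)}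
    (hx : x ∈ φ.target) (hgx : g • φ.symm x ∈ φ.source)
    (hg : ContDiffAt ℝ ∞ (chartSMul φ g) x) :
    σ x = |LinearMap.det (fderiv ℝ (chartSMul φ g) x :
      EuclideanSpace ℝ (Fin n) →ₗ[ℝ] EuclideanSpace ℝ (Fin n))| * σ (chartSMul φ g x) := by
  have h1 : ∀ᶠ z in 𝓝 x, z ∈ φ.target ∧ g • φ.symm z ∈ φ.source ∧
      ContDiffAt ℝ 1 (chartSMul φ g) z := by
    have hc : ContinuousAt (fun z => g • φ.symm z) x :=
      ((continuous_const_smul g).continuousAt).comp (φ.continuousAt_symm hx)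
    exact (φ.open_target.eventually_mem hx).and
      ((hc.eventually (φ.open_source.mem_nhds hgx)).and
        ((hg.of_le (by exact_mod_cast le_top)).eventually (by simp)))
  obtain ⟨U, hU, hUo, hxU⟩ := eventually_nhds_iff.1 h1
  have hinj : InjOn (chartSMul φ g) U := fun a ha b hb hab =>
    φ.symm.injOn (hU a ha).1 (hU b hb).1 (MulAction.injective g
      (φ.injOn (hU a ha).2.1 (hU b hb).2.1 hab))
  have hd : ContDiffOn ℝ 1 (chartSMul φ g) U := fun z hz => (hU z hz).2.2.contDiffWithinAt
  refine density_eq_abs_det_mul volume hUo hxU φ.open_target hσ.smooth.continuousOn hσ.pos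
    (fun z hz => (hU z hz).1) hd (fun z hz => φ.map_source (hU z hz).2.1) hinj
    fun A hA hAU => ?_
  rw [← hσ.measure_eq A hA fun z hz => (hU z (hAU hz)).1,
    ← hσ.measure_eq (chartSMul φ g '' A)
      (hA.image_of_continuousOn_injOn (hd.continuousOn.mono hAU) (hinj.mono hAU))
      (by rintro _ ⟨z, hz, rfl⟩; exact φ.map_source (hU z (hAU hz)).2.1),
    ← measure_smul_image hinv g]
  congr 1
  ext p
  constructor
  · rintro ⟨p, ⟨hp, hpA⟩, rfl⟩
    have h2 := (hU _ (hAU hpA)).2.1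
    rw [φ.left_inv hp] at h2
    exact ⟨h2, φ p, hpA, by simp only [chartSMul, φ.left_inv hp]⟩
  · rintro ⟨hp, z, hz, hzp⟩
    have h2 := hU z (hAU hz)
    exact ⟨φ.symm z, ⟨φ.map_target h2.1, by simpa [φ.right_inv h2.1] using hz⟩,
      φ.injOn h2.2.1 hp hzp⟩

end InvariantMeasure

/-! ### The derivative of the action at the origin, and the trace identity. -/

section InvariantDensity

variable {m n : ℕ} {G : Type*} [TopologicalSpace G] [ChartedSpace (EuclideanSpace ℝ (Fin m)) G]
  [Group G] [LieGroup (𝓡 m) ∞ G] {H : Subgroup G} [ChartedSpace (EuclideanSpace ℝ (Fin n)) (G ⧸ H)]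
  {φ : OpenPartialHomeomorph (G ⧸ H) (EuclideanSpace ℝ (Fin n))}

/-- Equivariance of the projection, `g • π(p) = π(g p)`, in coordinates. -/
lemma chartSMul_comp_cosetCoord {z : EuclideanSpace ℝ (Fin m)} (hz : z ∈ (chartOne m G).target)
    (ho : ((1 : G) : G ⧸ H) ∈ φ.source) :
    chartSMul φ ((chartOne m G).symm z) ∘ cosetCoord H φ =ᶠ[𝓝 (coordOne m G)]
      cosetCoord H φ ∘ chartMul m G z := by
  have : ContinuousAt (fun w => (chartOne m G).symm z * (chartOne m G).symm w) (coordOne m G) := by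
    have h := (contMDiffOn_symm_mul_symm (m := m) (G := G)).continuousOn.continuousAt
      (x := (z, coordOne m G)) (((chartOne m G).open_target.prod
        (chartOne m G).open_target).mem_nhds ⟨hz, coordOne_mem_target⟩)
    exact h.comp (f := fun w => (z, w)) (by fun_prop)
  have h1 : (chartOne m G).symm z * (chartOne m G).symm (coordOne m G) ∈ (chartOne m G).source := by
    rw [chartOne_symm_coordOne, mul_one]
    exact (chartOne m G).map_target hz
  filter_upwards [isOpen_cosetDomain.mem_nhds (coordOne_mem_cosetDomain (m := m) ho),
    this.eventually ((chartOne m G).open_source.mem_nhds h1)] with w hw hw'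
  simp only [Function.comp, chartSMul, cosetCoord, chartMul]
  rw [φ.left_inv hw.2, (chartOne m G).left_inv hw']
  rfl

/-- Inverse function theorem for `q` restricted to the affine slice `z₀ + 𝔪`, whose derivative at
`z₀` is the isomorphism `b`. -/
lemma exists_contDiffAt_section (hH : IsSmoothCosetSpace m n H)
    (hφ : φ ∈ IsManifold.maximalAtlas (𝓡 n) ∞ (G ⧸ H)) (ho : ((1 : G) : G ⧸ H) ∈ φ.source)
    {𝔪 : Submodule ℝ (EuclideanSpace ℝ (Fin m))} (h𝔪 : IsCompl (subgroupLieAlgebra m H) 𝔪) :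
    ∃ s : EuclideanSpace ℝ (Fin n) → EuclideanSpace ℝ (Fin m),
      ContDiffAt ℝ ∞ s (φ ((1 : G) : G ⧸ H)) ∧ s (φ ((1 : G) : G ⧸ H)) = coordOne m G ∧
      ∀ᶠ x in 𝓝 (φ ((1 : G) : G ⧸ H)), cosetCoord H φ (s x) = x := by
  let f : 𝔪 → EuclideanSpace ℝ (Fin n) := fun w =>
    cosetCoord H φ (coordOne m G + (w : EuclideanSpace ℝ (Fin m)))
  have hj : ContDiffAt ℝ ∞ (fun w : 𝔪 => coordOne m G + (w : EuclideanSpace ℝ (Fin m))) 0 :=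
    contDiffAt_const.add 𝔪.subtypeL.contDiff.contDiffAt
  have hj0 : coordOne m G + ((0 : 𝔪) : EuclideanSpace ℝ (Fin m)) = coordOne m G := by simp
  have hf0 : f 0 = φ ((1 : G) : G ⧸ H) := by
    simp only [f]
    rw [hj0, cosetCoord_coordOne]
  have hz0 := coordOne_mem_cosetDomain (m := m) ho
  have hf : ContDiffAt ℝ ∞ f 0 := by
    refine ContDiffAt.comp (0 : 𝔪) (g := cosetCoord H φ) ?_ hj
    rw [hj0]
    exact (contDiffOn_cosetCoord hH hφ).contDiffAt (isOpen_cosetDomain.mem_nhds hz0)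
  have hf' : HasFDerivAt f (cosetFrameEquiv 𝔪 hH hφ ho h𝔪 : 𝔪 →L[ℝ] _) 0 := by
    have h1 : HasFDerivAt (fun w : 𝔪 => coordOne m G + (w : EuclideanSpace ℝ (Fin m)))
        𝔪.subtypeL 0 := 𝔪.subtypeL.hasFDerivAt.const_add _
    have h2 := hasFDerivAt_cosetCoord hH hφ hz0
    rw [← hj0] at h2
    refine (h2.comp (0 : 𝔪) h1).congr_fderiv ?_
    ext1 w
    rw [hj0]
    exact ((cosetFrameEquiv_apply hH hφ ho h𝔪 w).trans (cosetFrame_coordOne_apply _)).symm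
  have hn : (∞ : WithTop ℕ∞) ≠ 0 := by simp
  refine ⟨fun x => coordOne m G + hf.localInverse hf' hn x, ?_, ?_, ?_⟩
  · rw [← hf0]
    exact contDiffAt_const.add (𝔪.subtypeL.contDiff.contDiffAt.comp _ (hf.to_localInverse hf' hn))
  · have h1 := hf.localInverse_apply_image hf' hn
    rw [hf0] at h1
    simp [h1]
  · rw [← hf0]
    exact (hf.hasStrictFDerivAt' hf' hn).eventually_right_inverse

variable (𝔪 : Submodule ℝ (EuclideanSpace ℝ (Fin m))) in
/-- The linear section of the differential of `cosetCoord` at the identity with range `𝔪`. -/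
def cosetSection (hH : IsSmoothCosetSpace m n H)
    (hφ : φ ∈ IsManifold.maximalAtlas (𝓡 n) ∞ (G ⧸ H)) (ho : ((1 : G) : G ⧸ H) ∈ φ.source)
    (h𝔪 : IsCompl (subgroupLieAlgebra m H) 𝔪) :
    EuclideanSpace ℝ (Fin n) →L[ℝ] EuclideanSpace ℝ (Fin m) :=
  𝔪.subtypeL.comp (cosetFrameEquiv 𝔪 hH hφ ho h𝔪).symm.toContinuousLinearMap

/-- Smoothness of the action near `o` comes from that of the group multiplication: precompose the
equivariance relation with a local section. -/
lemma contDiffAt_chartSMul (hH : IsSmoothCosetSpace m n H)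
    (hφ : φ ∈ IsManifold.maximalAtlas (𝓡 n) ∞ (G ⧸ H)) (ho : ((1 : G) : G ⧸ H) ∈ φ.source)
    {𝔪 : Submodule ℝ (EuclideanSpace ℝ (Fin m))} (h𝔪 : IsCompl (subgroupLieAlgebra m H) 𝔪)
    {z : EuclideanSpace ℝ (Fin m)} (hz : z ∈ cosetDomain m H φ) :
    ContDiffAt ℝ ∞ (chartSMul φ ((chartOne m G).symm z)) (φ ((1 : G) : G ⧸ H)) := by
  obtain ⟨s, hs, hs0, hqs⟩ := exists_contDiffAt_section hH hφ ho h𝔪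
  have h1 := chartSMul_comp_cosetCoord (H := H) hz.1 ho
  rw [← hs0] at h1
  have h2 : chartSMul φ ((chartOne m G).symm z) =ᶠ[𝓝 (φ ((1 : G) : G ⧸ H))]
      (cosetCoord H φ ∘ chartMul m G z) ∘ s := by
    filter_upwards [hqs, hs.continuousAt.eventually h1] with x hx hx'
    rw [Function.comp_apply, hx] at hx'
    exact hx'
  refine ContDiffAt.congr_of_eventuallyEq (ContDiffAt.comp _ ?_ hs) h2
  rw [hs0]
  have h3 : chartMul m G z (coordOne m G) = z := by
    simp only [chartMul, chartOne_symm_coordOne, mul_one, (chartOne m G).right_inv hz.1]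
  refine ContDiffAt.comp _ ?_ ((contDiffAt_chartMul_coordOne hz.1).comp (coordOne m G)
    (contDiffAt_const.prodMk contDiffAt_id : ContDiffAt ℝ ∞ (fun s => (z, s)) _))
  rw [h3]
  exact (contDiffOn_cosetCoord hH hφ).contDiffAt (isOpen_cosetDomain.mem_nhds hz)

/-- Differentiating equivariance at `z₀`, the derivative of the action composed with `Dq(z₀)` is
`Dq(z) ∘ L(z) = B(z)`; `cosetSection` is a right inverse of `Dq(z₀)`. -/
lemma fderiv_chartSMul (hH : IsSmoothCosetSpace m n H)
    (hφ : φ ∈ IsManifold.maximalAtlas (𝓡 n) ∞ (G ⧸ H)) (ho : ((1 : G) : G ⧸ H) ∈ φ.source)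
    {𝔪 : Submodule ℝ (EuclideanSpace ℝ (Fin m))} (h𝔪 : IsCompl (subgroupLieAlgebra m H) 𝔪)
    {z : EuclideanSpace ℝ (Fin m)} (hz : z ∈ cosetDomain m H φ) :
    fderiv ℝ (chartSMul φ ((chartOne m G).symm z)) (φ ((1 : G) : G ⧸ H)) =
      (cosetFrame H φ z).comp (cosetSection 𝔪 hH hφ ho h𝔪) := by
  have h1 := ((contDiffAt_chartSMul hH hφ ho h𝔪 hz).differentiableAt (by simp)).hasFDerivAt
  rw [← cosetCoord_coordOne (m := m)] at h1
  have h2 := h1.comp _ (hasFDerivAt_cosetCoord hH hφ (coordOne_mem_cosetDomain ho))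
  have h3 : chartMul m G z (coordOne m G) = z := by
    simp only [chartMul, chartOne_symm_coordOne, mul_one, (chartOne m G).right_inv hz.1]
  have h4 := hasFDerivAt_cosetCoord hH hφ hz
  nth_rewrite 2 [← h3] at h4
  have h5 := (h4.comp _ (hasFDerivAt_chartMul hz.1)).congr_of_eventuallyEq
    (chartSMul_comp_cosetCoord (H := H) hz.1 ho)
  have h6 := h2.unique h5
  rw [cosetCoord_coordOne] at h6
  ext1 x
  obtain ⟨w, rfl⟩ := (cosetFrameEquiv 𝔪 hH hφ ho h𝔪).surjective x
  have h7 := congrArg (fun L : EuclideanSpace ℝ (Fin m) →L[ℝ] EuclideanSpace ℝ (Fin n) => L w) h6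
  simp only [cosetSection, ContinuousLinearMap.comp_apply, ContinuousLinearEquiv.coe_coe,
    ContinuousLinearEquiv.symm_apply_apply]
  rw [cosetFrameEquiv_apply, cosetFrame_coordOne_apply]
  exact h7

variable [MeasurableSpace (G ⧸ H)] [BorelSpace (G ⧸ H)] {μ : Measure (G ⧸ H)}
  {σ : EuclideanSpace ℝ (Fin n) → ℝ}

lemma density_mul_abs_det_cosetFrame (hH : IsSmoothCosetSpace m n H)
    (hφ : φ ∈ IsManifold.maximalAtlas (𝓡 n) ∞ (G ⧸ H)) (ho : ((1 : G) : G ⧸ H) ∈ φ.source)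
    {𝔪 : Submodule ℝ (EuclideanSpace ℝ (Fin m))} (h𝔪 : IsCompl (subgroupLieAlgebra m H) 𝔪)
    (hσ : IsDensityInChart μ φ σ) (hinv : ∀ g : G, μ.map (fun x : G ⧸ H => g • x) = μ)
    {z : EuclideanSpace ℝ (Fin m)} (hz : z ∈ cosetDomain m H φ) :
    |LinearMap.det (((cosetFrame H φ z).comp (cosetSection 𝔪 hH hφ ho h𝔪) :
          EuclideanSpace ℝ (Fin n) →L[ℝ] EuclideanSpace ℝ (Fin n)) :
        EuclideanSpace ℝ (Fin n) →ₗ[ℝ] EuclideanSpace ℝ (Fin n))| *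
      σ (cosetCoord H φ z) = σ (φ ((1 : G) : G ⧸ H)) := by
  have h0 : (chartOne m G).symm z • φ.symm (φ ((1 : G) : G ⧸ H)) =
      ((chartOne m G).symm z : G ⧸ H) := by
    rw [φ.left_inv ho, MulAction.Quotient.smul_coe, smul_eq_mul, mul_one]
  have := topologicalGroup_of_lieGroup (𝓡 m) ∞ (G := G)
  rw [← fderiv_chartSMul hH hφ ho h𝔪 hz, density_eq_abs_det_chartSMul_mul hσ hinv
    (φ.map_source ho) (by rw [h0]; exact hz.2) (contDiffAt_chartSMul hH hφ ho h𝔪 hz), chartSMul, h0]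
  rfl

/-- Differentiate the constant function `|det (B(z) ∘ b⁻¹)| σ(q(z))` along the line `z₀ + t y` at `t
= 0`, where the operator is the identity and the derivative of its determinant is a trace. -/
lemma trace_fderiv_cosetFrame (hH : IsSmoothCosetSpace m n H)
    (hφ : φ ∈ IsManifold.maximalAtlas (𝓡 n) ∞ (G ⧸ H)) (ho : ((1 : G) : G ⧸ H) ∈ φ.source)
    {𝔪 : Submodule ℝ (EuclideanSpace ℝ (Fin m))} (h𝔪 : IsCompl (subgroupLieAlgebra m H) 𝔪)
    (hσ : IsDensityInChart μ φ σ) (hinv : ∀ g : G, μ.map (fun x : G ⧸ H => g • x) = μ)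
    (y : EuclideanSpace ℝ (Fin m)) :
    LinearMap.trace ℝ (EuclideanSpace ℝ (Fin n))
        ((fderiv ℝ (cosetFrame H φ) (coordOne m G) y).comp
          (cosetSection 𝔪 hH hφ ho h𝔪) :
            EuclideanSpace ℝ (Fin n) →L[ℝ] EuclideanSpace ℝ (Fin n)).toLinearMap =
      -(fderiv ℝ σ (φ ((1 : G) : G ⧸ H)) (cosetFrame H φ (coordOne m G) y) /
        σ (φ ((1 : G) : G ⧸ H))) := by
  have hz0 := coordOne_mem_cosetDomain (m := m) ho
  let M : ℝ → EuclideanSpace ℝ (Fin n) →L[ℝ] EuclideanSpace ℝ (Fin n) := fun t =>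
    (cosetFrame H φ (coordOne m G + t • y)).comp (cosetSection 𝔪 hH hφ ho h𝔪)
  have hl : HasDerivAt (fun t : ℝ => coordOne m G + t • y) y 0 := by
    simpa using ((hasDerivAt_id (0 : ℝ)).smul_const y).const_add (coordOne m G)
  have hl0 : coordOne m G + (0 : ℝ) • y = coordOne m G := by simp
  have hM0 : M 0 = ContinuousLinearMap.id ℝ _ := by
    simp only [M]
    rw [hl0]
    ext1 x
    exact (cosetFrameEquiv 𝔪 hH hφ ho h𝔪).apply_symm_apply x
  have hB : HasDerivAt (fun t : ℝ => cosetFrame H φ (coordOne m G + t • y))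
      (fderiv ℝ (cosetFrame H φ) (coordOne m G) y) 0 :=
    ((contDiffAt_cosetFrame hH hφ hz0).differentiableAt (by simp)).hasFDerivAt.comp_hasDerivAt_of_eq
      0 hl hl0.symm
  have hM : HasDerivAt M ((fderiv ℝ (cosetFrame H φ) (coordOne m G) y).comp
      (cosetSection 𝔪 hH hφ ho h𝔪)) 0 := by
    exact ((ContinuousLinearMap.compL ℝ _ _ _).flip
      (cosetSection 𝔪 hH hφ ho h𝔪)).hasFDerivAt.comp_hasDerivAt 0 hB
  have hdet := hasDerivAt_det_of_eq_id hM hM0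
  have hq : HasDerivAt (fun t : ℝ => cosetCoord H φ (coordOne m G + t • y))
      (cosetFrame H φ (coordOne m G) y) 0 := by
    rw [cosetFrame_coordOne_apply]
    exact (hasFDerivAt_cosetCoord hH hφ hz0).comp_hasDerivAt_of_eq 0 hl hl0.symm
  have hs : HasDerivAt (fun t : ℝ => σ (cosetCoord H φ (coordOne m G + t • y)))
      (fderiv ℝ σ (φ ((1 : G) : G ⧸ H)) (cosetFrame H φ (coordOne m G) y)) 0 := by
    refine HasFDerivAt.comp_hasDerivAt_of_eq 0 ?_ hq (by rw [hl0, cosetCoord_coordOne])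
    exact ((hσ.smooth.contDiffAt (φ.open_target.mem_nhds (φ.map_source ho))).differentiableAt
      (by simp)).hasFDerivAt
  have hprod := hdet.mul hs
  have hconst : (fun t => LinearMap.det (M t : EuclideanSpace ℝ (Fin n) →ₗ[ℝ] _)) *
      (fun t : ℝ => σ (cosetCoord H φ (coordOne m G + t • y))) =ᶠ[𝓝 0]
      fun _ => σ (φ ((1 : G) : G ⧸ H)) := by
    -- The determinant is 1 at `t = 0`, hence positive nearby, and the absolute value can be
    -- dropped.
    have hpos : ∀ᶠ t in 𝓝 (0 : ℝ),
        0 < LinearMap.det (M t : EuclideanSpace ℝ (Fin n) →ₗ[ℝ] _) := by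
      refine hdet.continuousAt.eventually (lt_mem_nhds ?_)
      simp [hM0]
    have hmem := hl.continuousAt.eventually 
      (isOpen_cosetDomain.mem_nhds (by simpa using hz0))
    filter_upwards [hpos, hmem] with t ht ht'
    rw [Pi.mul_apply, ← density_mul_abs_det_cosetFrame hH hφ ho h𝔪 hσ hinv ht']
    exact congrArg (· * _) (abs_of_pos ht).symm
  have hzero := hprod.unique ((hasDerivAt_const 0 _).congr_of_eventuallyEq hconst)
  have hσ0 := hσ.pos _ (φ.map_source ho)
  rw [hM0, hl0, cosetCoord_coordOne] at hzero
  rw [eq_neg_iff_add_eq_zero, ← mul_right_inj' hσ0.ne', mul_zero, mul_add,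
    mul_div_cancel₀ _ hσ0.ne', ← hzero]
  simp [mul_comm]

end InvariantDensity

/-! ### Taking traces and comparing with the S-curvature. -/

section SCurvature

variable {m n : ℕ} {G : Type*} [TopologicalSpace G] [ChartedSpace (EuclideanSpace ℝ (Fin m)) G]
  [Group G] [LieGroup (𝓡 m) ∞ G] {H : Subgroup G} [ChartedSpace (EuclideanSpace ℝ (Fin n)) (G ⧸ H)]
  [IsManifold (𝓡 n) ∞ (G ⧸ H)] {φ : OpenPartialHomeomorph (G ⧸ H) (EuclideanSpace ℝ (Fin n))}
  {S : Spray n (G ⧸ H)} {𝔪 : Submodule ℝ (EuclideanSpace ℝ (Fin m))}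

lemma Spray.sCurvatureInChart_of_stdCoord_eq {σ : EuclideanSpace ℝ (Fin n) → ℝ}
    {p : TangentBundle (𝓡 n) (G ⧸ H)} {x v : EuclideanSpace ℝ (Fin n)}
    (h : stdCoord φ p = (x, v)) :
    S.sCurvatureInChart φ σ p =
      LinearMap.trace ℝ (EuclideanSpace ℝ (Fin n))
        (fderiv ℝ (coeff S.toFun φ x) v).toLinearMap - fderiv ℝ σ x v / σ x := by
  rw [Spray.sCurvatureInChart, h]

/-- Conjugation by `b` preserves the trace, and `cosetFrame_connectionOperator_add_adM` identifies
the conjugated operator. -/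
lemma trace_connectionOperator_add_adM (hH : IsSmoothCosetSpace m n H)
    (hφ : φ ∈ IsManifold.maximalAtlas (𝓡 n) ∞ (G ⧸ H)) (ho : ((1 : G) : G ⧸ H) ∈ φ.source)
    (h𝔪 : IsCompl (subgroupLieAlgebra m H) 𝔪) {y : 𝔪} (hy : y ≠ 0) {T : 𝔪 →ₗ[ℝ] 𝔪}
    (hT : connectionOperator (G := G) S h𝔪 y + adM (G := G) h𝔪 y = T) :
    LinearMap.trace ℝ 𝔪 T =
      LinearMap.trace ℝ (EuclideanSpace ℝ (Fin n))
        (fderiv ℝ (coeff S.toFun φ (φ ((1 : G) : G ⧸ H)))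
          (cosetFrame H φ (coordOne m G) y)).toLinearMap +
      LinearMap.trace ℝ (EuclideanSpace ℝ (Fin n))
        ((fderiv ℝ (cosetFrame H φ) (coordOne m G) y).comp
          (cosetSection 𝔪 hH hφ ho h𝔪) :
            EuclideanSpace ℝ (Fin n) →L[ℝ] EuclideanSpace ℝ (Fin n)).toLinearMap := by
  let b := (cosetFrameEquiv 𝔪 hH hφ ho h𝔪).toLinearEquiv
  rw [← LinearMap.trace_conj' T b, ← map_add]
  congr 1
  ext1 x
  obtain ⟨w, rfl⟩ := b.surjective x
  rw [LinearEquiv.conj_apply_apply, b.symm_apply_apply]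
  refine (cosetFrame_connectionOperator_add_adM hH hφ ho h𝔪 hy
    (congrArg (fun L : 𝔪 →ₗ[ℝ] 𝔪 => L w) hT)).trans ?_
  have h1 : cosetSection 𝔪 hH hφ ho h𝔪 (b w) = w :=
    congrArg Subtype.val (b.symm_apply_apply w)
  rw [LinearMap.add_apply]
  refine congrArg₂ (· + ·) rfl ?_
  exact congrArg (fderiv ℝ (cosetFrame H φ) (coordOne m G) y) h1.symm

end SCurvature

end SprayGeometry

end

theorem theorem6p3 {m n : ℕ} {G : Type*} [TopologicalSpace G]
    [ChartedSpace (EuclideanSpace ℝ (Fin m)) G] [Group G] [LieGroup (𝓡 m) ∞ G]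
    (H : Subgroup G) [ChartedSpace (EuclideanSpace ℝ (Fin n)) (G ⧸ H)]
    [IsManifold (𝓡 n) ∞ (G ⧸ H)] (hH : SprayGeometry.IsSmoothCosetSpace m n H)
    [MeasurableSpace (G ⧸ H)] [BorelSpace (G ⧸ H)]
    (S : SprayGeometry.Spray n (G ⧸ H))
    (hS : ∀ g : G, S.IsInvariantUnder fun x : G ⧸ H => g • x)
    (𝔪 : Submodule ℝ (GroupLieAlgebra (𝓡 m) G))
    (h𝔪 : IsCompl (SprayGeometry.subgroupLieAlgebra m H) 𝔪)
    (hunimod : SprayGeometry.IsAdUnimodular m H)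
    (μ : Measure (G ⧸ H)) (hμ : SprayGeometry.IsSmoothMeasure n μ)
    (hinv : ∀ g : G, μ.map (fun x : G ⧸ H => g • x) = μ)
    (y : 𝔪) (hy : y ≠ 0)
    (φ : OpenPartialHomeomorph (G ⧸ H) (EuclideanSpace ℝ (Fin n)))
    (hφ : φ ∈ IsManifold.maximalAtlas (𝓡 n) ∞ (G ⧸ H))
    (ho : ((1 : G) : G ⧸ H) ∈ φ.source)
    (σ : EuclideanSpace ℝ (Fin n) → ℝ) (hσ : SprayGeometry.IsDensityInChart μ φ σ) :
    S.sCurvatureInChart φ σ (SprayGeometry.toOrigin m n H y) =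
      LinearMap.trace ℝ 𝔪
        (SprayGeometry.connectionOperator S h𝔪 y + SprayGeometry.adM h𝔪 y) := by
  refine Eq.trans ?_ (SprayGeometry.trace_connectionOperator_add_adM hH hφ ho h𝔪 hy rfl).symm
  rw [SprayGeometry.trace_fderiv_cosetFrame hH hφ ho h𝔪 hσ hinv, ← sub_eq_add_neg]
  exact SprayGeometry.Spray.sCurvatureInChart_of_stdCoord_eq
    (SprayGeometry.stdCoord_toOrigin hH hφ ho _)
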